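/- Let $d$ be a positive integer and let $\mathcal{A}$ be an (essentially small) abelian category in which every object has finite length. All subcategories are full and closed under isomorphisms and finite direct sums. Let $\mathcal{M}\subseteq\mathcal{A}$ be a $d$-cluster tilting subcategory, that is, $\mathcal{M}$ is functorially finite, every object of $\mathcal{A}$ is a quotient of an object of $\mathcal{M}$ and a subobject of an object of $\mathcal{M}$, and $$\mathcal{M}=\{X\in\mathcal{A}\mid \operatorname{Ext}^i_{\mathcal{A}}(X,M)=0 \text{ for all } M\in\mathcal{M},\ 1\le i\le d-1\}=\{Y\in\mathcal{A}\mid \operatorname{Ext}^i_{\mathcal{A}}(M,Y)=0 \text{ for all } M\in\mathcal{M},\ 1\le i\le d-1\}.$$ A $d$-cokernel of a morphism $f_0\colon X_0\to X_1$ in $\mathcal{M}$ is a sequence $X_1\xrightarrow{f_1}X_2\to\cdots\to X_d\xrightarrow{f_d}X_{d+1}\to 0$ in $\mathcal{M}$ such that for every $M\in\mathcal{M}$ the sequence $0\to\operatorname{Hom}(X_{d+1},M)\to\operatorname{Hom}(X_d,M)\to\cdots\to\operatorname{Hom}(X_1,M)\to\operatorname{Hom}(X_0,M)$ is exact; $d$-kernels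 are defined dually. A $d$-extension in $\mathcal{M}$ is a sequence $0\to X_0\xrightarrow{f_0}X_1\to\cdots\to X_d\xrightarrow{f_d}X_{d+1}\to0$ in $\mathcal{M}$ such that $(f_1,\dots,f_d)$ is a $d$-cokernel of $f_0$ and $(f_0,\dots,f_{d-1})$ is a $d$-kernel of $f_d$. Its end terms are $X_0$ and $X_{d+1}$. A $d$-extension is equivalent to another one with the same end terms if there is a morphism of sequences from the first to the second which is the identity on both end terms. Let $\mathcal{U}\subseteq\mathcal{M}$ be a subcategory that is closed under direct summands. Suppose that: 1. $\mathcal{U}$ is closed under $d$-quotients: every morphism $f\colon M\to U$ in $\mathcal{M}$ with $U\in\mathcal{U}$ has a $d$-cokernel $U\to E_1\to\cdots\to E_d\to0$ with $E_1,\dots,E_d\in\mathcal{U}$; 2. $\mathcal{U}$ is closed under $d$-extensions with indecomposable end terms: every $d$-extension $0\to X\to E_1\to\cdots\to E_d\to Y\to0$ in $\mathcal{M}$ with $X,Y\in\mathcal{U}$ indecomposable is equivalent to a $d$-extension all of whose terms lie in $\mathcal{U}$. Then $\mathcal{U}$ is closed under all $d$-extensions: every $d$-extension $0\to X\to E_1\to\cdots\to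 E_d\to Y\to0$ in $\mathcal{M}$ with $X,Y\in\mathcal{U}$ is equivalent to a $d$-extension all of whose terms lie in $\mathcal{U}$. -/

import Mathlib

universe w v u

open CategoryTheory CategoryTheory.Limits CategoryTheory.Abelian

namespace HigherExt

variable {A : Type u} [Category.{v} A] [Abelian A]

/-- The category `A` is a finite length category: each object satisfies both chain conditions
on subobjects (equivalently, has a composition series). -/
structure IsLengthCategory (A : Type u) [Category.{v} A] [Abelian A] : Prop where
  artinian : ∀ X : A, IsArtinianObject X
  noetherian : ∀ X : A, IsNoetherianObject X

/-- A (full) subcategory closed under isomorphisms and finite direct sums. -/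
structure IsAdditiveSubcategory (P : ObjectProperty A) : Prop where
  of_iso : ∀ {X Y : A}, (X ≅ Y) → P X → P Y
  zero : ∀ {X : A}, IsZero X → P X
  biprod : ∀ {X Y : A}, P X → P Y → P (X ⊞ Y)

/-- `f : Y ⟶ X` is a left `P`-approximation of `Y`. -/
def IsLeftApproximation (P : ObjectProperty A) {Y X : A} (f : Y ⟶ X) : Prop :=
  P X ∧ ∀ (X' : A), P X' → ∀ g : Y ⟶ X', ∃ h : X ⟶ X', f ≫ h = g

/-- `f : X ⟶ Y` is a right `P`-approximation of `Y`. -/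
def IsRightApproximation (P : ObjectProperty A) {X Y : A} (f : X ⟶ Y) : Prop :=
  P X ∧ ∀ (X' : A), P X' → ∀ g : X' ⟶ Y, ∃ h : X' ⟶ X, h ≫ f = g

/-- Every object has a left and a right `P`-approximation. -/
structure IsFunctoriallyFinite (P : ObjectProperty A) : Prop where
  covariantly : ∀ Y : A, ∃ (X : A) (f : Y ⟶ X), IsLeftApproximation P f
  contravariantly : ∀ Y : A, ∃ (X : A) (f : X ⟶ Y), IsRightApproximation P f

/-- Every object is a quotient of an object of `P`. -/
def IsGenerating (P : ObjectProperty A) : Prop :=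
  ∀ Y : A, ∃ (X : A) (p : X ⟶ Y), P X ∧ Epi p

/-- Every object is a subobject of an object of `P`. -/
def IsCogenerating (P : ObjectProperty A) : Prop :=
  ∀ Y : A, ∃ (X : A) (i : Y ⟶ X), P X ∧ Mono i

/-- `d`-cluster tilting subcategories of the abelian category `A`. -/
structure IsClusterTilting [HasExt.{w} A] (d : ℕ) (M : ObjectProperty A) : Prop where
  additive : IsAdditiveSubcategory M
  functoriallyFinite : IsFunctoriallyFinite M
  generating : IsGenerating M
  cogenerating : IsCogenerating M
  mem_iff_ext_left : ∀ X : A, M X ↔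
    ∀ N : A, M N → ∀ i : ℕ, 1 ≤ i → i < d → Subsingleton (Ext X N i)
  mem_iff_ext_right : ∀ Y : A, M Y ↔
    ∀ N : A, M N → ∀ i : ℕ, 1 ≤ i → i < d → Subsingleton (Ext N Y i)

/-- For a sequence `X₀ ⟶ X₁ ⟶ ⋯ ⟶ X_{d+1}` with maps `f₀, …, f_d`: all terms lie in `M` and
`(f₁, …, f_d)` is a `d`-cokernel of `f₀` in `M`, that is, for each `N` in `M` the sequence
`0 ⟶ Hom(X_{d+1}, N) ⟶ Hom(X_d, N) ⟶ ⋯ ⟶ Hom(X₁, N) ⟶ Hom(X₀, N)` is exact. -/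
structure IsDCokernel (M : ObjectProperty A) {d : ℕ} (S : ComposableArrows A (d + 1)) : Prop where
  mem : ∀ i, M (S.obj i)
  injective : ∀ N : A, M N →
    Function.Injective (fun g : S.obj' (d + 1) ⟶ N => S.map' d (d + 1) ≫ g)
  exact : ∀ N : A, M N → ∀ (i : ℕ) (hi : i < d),
    Function.Exact (fun g : S.obj' (i + 2) ⟶ N => S.map' (i + 1) (i + 2) ≫ g)
      (fun g : S.obj' (i + 1) ⟶ N => S.map' i (i + 1) ≫ g)

/-- For a sequence `X₀ ⟶ X₁ ⟶ ⋯ ⟶ X_{d+1}` with maps `f₀, …, f_d`: all terms lie in `M` and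
`(f₀, …, f_{d-1})` is a `d`-kernel of `f_d` in `M`, that is, for each `N` in `M` the sequence
`0 ⟶ Hom(N, X₀) ⟶ Hom(N, X₁) ⟶ ⋯ ⟶ Hom(N, X_d) ⟶ Hom(N, X_{d+1})` is exact. -/
structure IsDKernel (M : ObjectProperty A) {d : ℕ} (S : ComposableArrows A (d + 1)) : Prop where
  mem : ∀ i, M (S.obj i)
  injective : ∀ N : A, M N →
    Function.Injective (fun g : N ⟶ S.obj' 0 => g ≫ S.map' 0 1)
  exact : ∀ N : A, M N → ∀ (i : ℕ) (hi : i < d),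
    Function.Exact (fun g : N ⟶ S.obj' i => g ≫ S.map' i (i + 1))
      (fun g : N ⟶ S.obj' (i + 1) => g ≫ S.map' (i + 1) (i + 2))

/-- A `d`-extension `0 ⟶ X ⟶ E₁ ⟶ ⋯ ⟶ E_d ⟶ Y ⟶ 0` in `M` with end terms `X` and `Y`. The first
and last objects of the underlying sequence are identified with `X` and `Y` by chosen
isomorphisms, rather than by equalities of objects. -/
structure DExtension (M : ObjectProperty A) (d : ℕ) (X Y : A) where
  seq : ComposableArrows A (d + 1)
  isoLeft : seq.left ≅ X
  isoRight : seq.right ≅ Y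
  isDCokernel : IsDCokernel M seq
  isDKernel : IsDKernel M seq

/-- Two `d`-extensions with the same end terms are equivalent if there is a morphism of sequences
from the first to the second which is the identity on both end terms. -/
def DExtension.Equivalent {M : ObjectProperty A} {d : ℕ} {X Y : A}
    (E E' : DExtension M d X Y) : Prop :=
  ∃ φ : E.seq ⟶ E'.seq,
    ComposableArrows.app' φ 0 ≫ E'.isoLeft.hom = E.isoLeft.hom ∧
    ComposableArrows.app' φ (d + 1) ≫ E'.isoRight.hom = E.isoRight.hom

/-- `U` is closed under `d`-extensions in `M`. -/
def ClosedUnderDExtensions (M U : ObjectProperty A) (d : ℕ) : Prop :=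
  ∀ X Y : A, U X → U Y → ∀ E : DExtension M d X Y,
    ∃ E' : DExtension M d X Y, E.Equivalent E' ∧ ∀ i, U (E'.seq.obj i)

/-- `U` is closed under `d`-extensions in `M` with indecomposable end terms. -/
def ClosedUnderIndecDExtensions (M U : ObjectProperty A) (d : ℕ) : Prop :=
  ∀ X Y : A, Indecomposable X → Indecomposable Y → U X → U Y → ∀ E : DExtension M d X Y,
    ∃ E' : DExtension M d X Y, E.Equivalent E' ∧ ∀ i, U (E'.seq.obj i)

/-- `U` is closed under `d`-quotients in `M`: each morphism `f : N ⟶ V` in `M` with `V` in `U` has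
a `d`-cokernel `V ⟶ E₁ ⟶ ⋯ ⟶ E_d ⟶ 0` in `M` with all `Eᵢ` in `U`. (The first map of the
sequence is `f` up to an isomorphism of arrows.) -/
def ClosedUnderDQuotients (M U : ObjectProperty A) (d : ℕ) : Prop :=
  ∀ (N V : A) (f : N ⟶ V), M N → U V →
    ∃ S : ComposableArrows A (d + 1), IsDCokernel M S ∧
      Nonempty (Arrow.mk (S.map' 0 1) ≅ Arrow.mk f) ∧
      ∀ (i : ℕ) (hi : i < d), U (S.obj' (i + 2))

end HigherExt

/-! A `d`-extension in `M` has a Yoneda class in `Ext Y X d`. Every class between objects of `M`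
arises in this way, and two `d`-extensions with the same end terms are equivalent exactly when their
classes agree. So it suffices to show that each class between objects of `U` is spliced from short
exact sequences with middle terms in `U`.

The working notion is `UniversallyKilled`: the morphisms `X ⟶ N` with `N` in `M` that kill `ε` are
generated by a single one, `j : X ⟶ G` with `G` in `U`. A splice in `U` has this property through
its first map. Conversely (`UniversallyKilled.splice`), the `d`-cokernel of `j` yields a sequence in
`U` with some class `ζ` from `X` to some `Z` in `U`; `ε` and `ζ` are pullbacks of each other, and
pulling the sequence back along `Y ⟶ Z` changes only its last middle term, which becomes a direct
summand of an object of `U`.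

Unlike the existence of a splice in `U`, this notion passes easily to direct sums. For `Y₁ ⊞ Y₂` the
two morphisms are glued by a pushout, a quotient of an object of `U`, and closure under
`d`-quotients returns it to `U` (`of_biprod_left`). For `X₁ ⊞ X₂` a splice of the first component
reduces the second one to another class on `X₂` (`of_biprod_right`). Decomposing objects into
indecomposables then finishes the proof. -/

namespace HigherExt

/-! ### Effaceability of Ext classes of positive degree -/

section Effaceability

open DerivedCategory HomologicalComplex

variable {C : Type u} [Category.{v} C] [Abelian C]

/-- As `K` vanishes above degree `i`, all of `K.X i` consists of cycles and maps onto the homology,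
which is `Y`; hence `P` is `K.X i`. -/
lemma exists_epi_lift_of_quasiIsoAt_single {Y : C} {K : CochainComplex C ℤ} {i : ℤ}
    (π : K ⟶ (single C (ComplexShape.up ℤ) i).obj Y) [K.IsStrictlyLE i] [hπ : QuasiIsoAt π i] :
    ∃ (P : C) (p : P ⟶ Y) (σ : (single C (ComplexShape.up ℤ) i).obj P ⟶ K),
      Epi p ∧ σ ≫ π = (single C (ComplexShape.up ℤ) i).map p := by
  have h0 : IsZero (K.X (i + 1)) := K.isZero_of_isStrictlyLE i (i + 1) (by simp)
  let e := K.iCyclesIso i (i + 1) (by simp) (h0.eq_of_tgt _ _)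
  have : IsIso (homologyMap π i) := inferInstance
  obtain ⟨α, hα, hα'⟩ : ∃ α : K.X i ⟶ Y, Epi α ∧
      π.f i = α ≫ (singleObjXSelf (ComplexShape.up ℤ) i Y).inv := by
    refine ⟨e.inv ≫ K.homologyπ i ≫ homologyMap π i ≫
      (singleObjHomologySelfIso (ComplexShape.up ℤ) i Y).hom, inferInstance, ?_⟩
    rw [← cancel_epi e.hom]
    simp only [Category.assoc, Iso.hom_inv_id_assoc]
    rw [homologyπ_naturality_assoc, homologyπ_singleObjHomologySelfIso_hom_assoc,
      ← singleObjCyclesSelfIso_inv_iCycles, Iso.hom_inv_id_assoc]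
    exact (cyclesMap_i π i).symm
  have hd (j : ℤ) (hj : (ComplexShape.up ℤ).Rel i j) : 𝟙 (K.X i) ≫ K.d i j = 0 := by
    obtain rfl : i + 1 = j := hj
    exact h0.eq_of_tgt _ _
  refine ⟨K.X i, α, mkHomFromSingle (𝟙 _) hd, hα, ?_⟩
  apply HomologicalComplex.from_single_hom_ext
  rw [comp_f, mkHomFromSingle_f, hα', single_map_f_self]
  simp

/-- Write `φ` as a roof through a complex `K` bounded above by `i`. After pulling back to `P` it
becomes an honest chain map into `L`, which is zero in degree `i`. -/
lemma exists_epi_singleFunctor_map_comp_eq_zero [HasDerivedCategory.{w} C] {Y : C}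
    {L : CochainComplex C ℤ} {i : ℤ}
    (φ : Q.obj ((CochainComplex.singleFunctor C i).obj Y) ⟶ Q.obj L)
    (n : ℤ) (hn : n < i) [L.IsStrictlyLE n] :
    ∃ (P : C) (p : P ⟶ Y), Epi p ∧
      Q.map ((CochainComplex.singleFunctor C i).map p) ≫ φ = 0 := by
  obtain ⟨K, _, π, h, g, rfl⟩ := right_fac_of_isStrictlyLE φ i
  have hπ : QuasiIso π := by rwa [isIso_Q_map_iff_quasiIso] at h
  have hπ' : QuasiIsoAt π i := hπ.quasiIsoAt i
  obtain ⟨P, p, σ, hp, hσ⟩ : ∃ (P : C) (p : P ⟶ Y)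
      (σ : (CochainComplex.singleFunctor C i).obj P ⟶ K), Epi p ∧
        σ ≫ π = (CochainComplex.singleFunctor C i).map p :=
    exists_epi_lift_of_quasiIsoAt_single (Y := Y) (i := i) π (hπ := hπ')
  have h₂ : σ ≫ g = 0 := by
    apply HomologicalComplex.from_single_hom_ext
    apply (L.isZero_of_isStrictlyLE n i hn).eq_of_tgt
  refine ⟨P, p, hp, ?_⟩
  rw [← hσ, Q.map_comp, Category.assoc, IsIso.hom_inv_id_assoc, ← Q.map_comp, h₂, Q.map_zero]

/-- Classes in positive degree are effaceable. -/
lemma exists_epi_comp_eq_zero [HasExt.{w} C] {X Y : C} {n : ℕ} (e : Ext Y X (n + 1)) :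
    ∃ (P : C) (p : P ⟶ Y), Epi p ∧ (Ext.mk₀ p).comp e (zero_add (n + 1)) = 0 := by
  let := HasDerivedCategory.standard C
  obtain ⟨P, p, hp, h⟩ := exists_epi_singleFunctor_map_comp_eq_zero
    (L := (CochainComplex.singleFunctor C (-(n + 1))).obj X) (n := -(n + 1)) (i := 0)
    (e.hom ≫ ((singleFunctors C).shiftIso (n + 1) (-(n + 1)) 0 (by lia)).hom.app _) (by lia)
  refine ⟨P, p, hp, ?_⟩
  apply Ext.homEquiv.injective
  simp only [← cancel_mono (((singleFunctors C).shiftIso (n + 1) (-(n + 1)) 0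
    (by lia)).hom.app _)]
  change ((Ext.mk₀ p).comp e (zero_add (n + 1))).hom ≫ _ = Ext.hom 0 ≫ _
  rw [← Ext.singleFunctor_map_comp_hom, Ext.zero_hom, Limits.zero_comp, Category.assoc]
  exact h

end Effaceability

/-! ### Pushouts and pullbacks of short exact sequences, and classes of degree one -/

section

variable {C : Type u} [Category.{v} C] [Abelian C]

lemma shortExact_cokernel {X Y : C} (i : X ⟶ Y) [Mono i] :
    (ShortComplex.mk i (cokernel.π i) (cokernel.condition i)).ShortExact where
  exact := ShortComplex.exact_cokernel i

lemma shortExact_kernel {X Y : C} (p : X ⟶ Y) [Epi p] :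
    (ShortComplex.mk (kernel.ι p) p (kernel.condition p)).ShortExact where
  exact := ShortComplex.exact_kernel p

attribute [local simp] pushout.inl_desc pushout.inr_desc pushout.inl_desc_assoc
  pushout.inr_desc_assoc pullback.lift_fst pullback.lift_snd pullback.lift_fst_assoc
  pullback.lift_snd_assoc

/-- The pushout of a short exact sequence along a morphism from its first term. -/
lemma shortExact_pushout {S : ShortComplex C} (hS : S.ShortExact) {Z : C} (u : S.X₁ ⟶ Z) :
    (ShortComplex.mk (pushout.inr S.f u) (pushout.desc S.g 0 (by simp)) (by simp)).ShortExact := by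
  have := hS.mono_f
  have := hS.epi_g
  have : Epi (pushout.desc S.g (0 : Z ⟶ S.X₃) (by simp : S.f ≫ S.g = u ≫ 0)) := by
    have : Epi (pushout.inl S.f u ≫ pushout.desc S.g (0 : Z ⟶ S.X₃) (by simp)) := by
      simpa
    exact epi_of_epi (pushout.inl S.f u) _
  refine { exact := ShortComplex.exact_of_g_is_cokernel _ ?_ }
  refine CokernelCofork.IsColimit.ofπ' _ _ fun {A} k hk => ?_
  have hk' : S.f ≫ pushout.inl S.f u ≫ k = 0 := by
    rw [pushout.condition_assoc]; dsimp at hk; simp [hk]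
  refine ⟨hS.exact.desc (pushout.inl S.f u ≫ k) hk', ?_⟩
  dsimp
  ext
  · simp
  · dsimp at hk; simp [hk]

/-- The pullback of a short exact sequence along a morphism to its last term. -/
lemma shortExact_pullback {S : ShortComplex C} (hS : S.ShortExact) {Z : C} (u : Z ⟶ S.X₃) :
    (ShortComplex.mk (pullback.lift S.f 0 (by simp) : S.X₁ ⟶ pullback S.g u) (pullback.snd S.g u)
      (by simp)).ShortExact := by
  have := hS.mono_f
  have := hS.epi_g
  have : Mono (pullback.lift S.f 0 (by simp) : S.X₁ ⟶ pullback S.g u) := by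
    have : Mono ((pullback.lift S.f 0 (by simp) : S.X₁ ⟶ pullback S.g u) ≫
      pullback.fst S.g u) := by simpa
    exact mono_of_mono _ (pullback.fst S.g u)
  refine { exact := ShortComplex.exact_of_f_is_kernel _ ?_ }
  refine KernelFork.IsLimit.ofι' _ _ fun {A} k hk => ?_
  have hk' : (k ≫ pullback.fst S.g u) ≫ S.g = 0 := by
    rw [Category.assoc, pullback.condition]; dsimp at hk; rw [reassoc_of% hk, zero_comp]
  refine ⟨hS.exact.lift (k ≫ pullback.fst S.g u) hk', ?_⟩
  dsimp
  ext
  · simp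
  · dsimp at hk; simp [hk]

variable [HasExt.{w} C]

lemma extClass_pushout {S : ShortComplex C} (hS : S.ShortExact) {Z : C} (u : S.X₁ ⟶ Z) :
    (shortExact_pushout hS u).extClass = hS.extClass.comp (Ext.mk₀ u) (add_zero 1) := by
  have := hS.extClass_naturality (shortExact_pushout hS u)
    { τ₁ := u, τ₂ := pushout.inl S.f u, τ₃ := 𝟙 _, comm₁₂ := pushout.condition.symm }
  dsimp at this
  rw [Ext.mk₀_id_comp] at this
  exact this.symm

lemma extClass_pullback {S : ShortComplex C} (hS : S.ShortExact) {Z : C} (u : Z ⟶ S.X₃) :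
    (shortExact_pullback hS u).extClass = (Ext.mk₀ u).comp hS.extClass (zero_add 1) := by
  have := (shortExact_pullback hS u).extClass_naturality hS
    { τ₁ := 𝟙 _, τ₂ := pullback.fst S.g u, τ₃ := u, comm₂₃ := pullback.condition }
  dsimp at this
  rw [Ext.comp_mk₀_id] at this
  exact this

/-- Every class in degree one is the class of a short exact sequence. -/
lemma exists_shortExact_extClass_eq {X Y : C} (e : Ext Y X 1) :
    ∃ (E : C) (f : X ⟶ E) (g : E ⟶ Y) (w : f ≫ g = 0)
      (hS : (ShortComplex.mk f g w).ShortExact), hS.extClass = e := by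
  obtain ⟨P, p, hp, h⟩ := exists_epi_comp_eq_zero e
  obtain ⟨x, hx⟩ := Ext.contravariant_sequence_exact₃ (shortExact_kernel p) X e h (add_zero 1)
  obtain ⟨u, rfl⟩ := (Ext.mk₀_bijective _ _).2 x
  exact ⟨_, _, _, _, shortExact_pushout (shortExact_kernel p) u,
    (extClass_pushout (shortExact_kernel p) u).trans hx⟩

end

end HigherExt

/-! ### Spliced exact sequences and dimension shifting -/

namespace HigherExt

variable {A : Type u} [Category.{v} A] [Abelian A] [HasExt.{w} A]

/-- `Splice P n X Y ε` says that `ε` is the class of an exact sequence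
`0 ⟶ X ⟶ E₁ ⟶ ⋯ ⟶ Eₙ ⟶ Y ⟶ 0` with all `Eᵢ` in `P`. -/
inductive Splice (P : ObjectProperty A) : ∀ (n : ℕ) (X Y : A), Ext.{w} Y X n → Prop
  | zero {X Y : A} (e : X ≅ Y) : Splice P 0 X Y (Ext.mk₀ e.inv)
  | succ {n : ℕ} {Y : A} (S : ShortComplex A) (hS : S.ShortExact) (hP : P S.X₂)
      (ε : Ext.{w} Y S.X₃ n) (h : Splice P n S.X₃ Y ε) :
      Splice P (n + 1) S.X₁ Y (ε.comp hS.extClass rfl)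

namespace Splice

variable {P Q M : ObjectProperty A} {d n : ℕ} {X Y : A} {ε : Ext.{w} Y X n}

lemma mono (hPQ : P ≤ Q) (h : Splice P n X Y ε) : Splice Q n X Y ε := by
  induction h with
  | zero e => exact .zero e
  | succ S hS hP ε _ ih => exact .succ S hS (hPQ _ hP) ε ih

lemma append {T : A} {f : Y ⟶ T} {Z : A} {g : T ⟶ Z} {w : f ≫ g = 0} (h : Splice P n X Y ε)
    (hS : (ShortComplex.mk f g w).ShortExact) (hP : P T) :
    Splice P (n + 1) X Z (hS.extClass.comp ε (add_comm 1 n)) := by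
  induction h with
  | @zero X Y e =>
    let i : ShortComplex.mk (e.hom ≫ f) g (by simp [w]) ≅ ShortComplex.mk f g w :=
      ShortComplex.isoMk e (Iso.refl _) (Iso.refl _)
    have hS' := ShortComplex.shortExact_of_iso i.symm hS
    have := Splice.succ _ hS' hP _ (.zero (Iso.refl _))
    have nat := hS.extClass_naturality hS' { τ₁ := e.inv, τ₂ := 𝟙 _, τ₃ := 𝟙 _ }
    dsimp at this nat
    rw [Ext.mk₀_id_comp] at this nat
    rwa [nat]
  | succ S hS₀ hP₀ ε h ih =>
    have := Splice.succ S hS₀ hP₀ _ (ih hS)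
    rwa [Ext.comp_assoc (h := by lia)] at this

/-- The last short exact sequence of a splice. -/
lemma exists_append {ε : Ext.{w} Y X (n + 1)} (h : Splice P (n + 1) X Y ε) :
    ∃ (K E : A) (f : K ⟶ E) (g : E ⟶ Y) (w : f ≫ g = 0)
      (hS : (ShortComplex.mk f g w).ShortExact) (ε₀ : Ext.{w} K X n),
      P E ∧ Splice P n X K ε₀ ∧ ε = hS.extClass.comp ε₀ (add_comm 1 n) := by
  induction n generalizing X with
  | zero =>
    obtain - | ⟨S, hS, hP, ε', h⟩ := h
    obtain ⟨e⟩ := h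
    let i : ShortComplex.mk S.f (S.g ≫ e.hom) (by simp) ≅ S :=
      ShortComplex.isoMk (Iso.refl _) (Iso.refl _) e.symm
    have hS' := ShortComplex.shortExact_of_iso i.symm hS
    have nat := hS'.extClass_naturality hS { τ₁ := 𝟙 _, τ₂ := 𝟙 _, τ₃ := e.inv }
    dsimp at nat
    rw [Ext.comp_mk₀_id] at nat
    exact ⟨S.X₁, S.X₂, S.f, S.g ≫ e.hom, _, hS', _, hP, .zero (Iso.refl _), by simp [nat]⟩
  | succ n ih =>
    obtain - | ⟨S, hS, hP, ε', h⟩ := h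
    obtain ⟨K, E, f, g, w, hS', ε₀, hE, h₀, rfl⟩ := ih h
    exact ⟨K, E, f, g, w, hS', _, hE, .succ S hS hP _ h₀, by rw [Ext.comp_assoc (h := by lia)]⟩

end Splice

lemma IsClusterTilting.ext_eq_zero {M : ObjectProperty A} {d : ℕ}
    (hM : IsClusterTilting.{w} d M) {X N : A} (hX : M X) (hN : M N) {i : ℕ} (h₁ : 1 ≤ i)
    (h₂ : i < d) (x : Ext.{w} X N i) : x = 0 :=
  ((hM.mem_iff_ext_left X).1 hX N hN i h₁ h₂).elim _ _

namespace Splice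

variable {P Q M : ObjectProperty A} {d n : ℕ} {X Y : A} {ε : Ext.{w} Y X n}
  (hM : IsClusterTilting.{w} d M)

include hM in
-- Dimension shifting: each connecting map on Ext into `N` is injective in the degrees concerned,
-- since the middle terms have no Ext into `N` there.
lemma eq_zero_of_comp_left (h : Splice M n X Y ε) {N : A} (hN : M N) {i c : ℕ} (hi : 1 ≤ i)
    (hc : n + i = c) (hd : c ≤ d) (x : Ext.{w} X N i) (hx : ε.comp x hc = 0) : x = 0 := by
  induction h generalizing i with
  | zero e =>
    obtain rfl : i = c := by lia
    rw [← Ext.mk₀_id_comp x, ← e.hom_inv_id, ← Ext.mk₀_comp_mk₀_assoc, hx, Ext.comp_zero]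
  | @succ n Y S hS hP ε _ ih =>
    have h0 : hS.extClass.comp x (add_comm 1 i) = 0 := by
      refine ih (by lia) (by lia) _ ?_
      rwa [Ext.comp_assoc (h₂₃ := add_comm 1 i) (h := by lia)] at hx
    obtain ⟨y, rfl⟩ := Ext.contravariant_sequence_exact₁ hS N x _ h0
    rw [hM.ext_eq_zero hP hN hi (by lia) y, Ext.comp_zero]

include hM in
lemma eq_zero_of_comp_right (h : Splice M n X Y ε) {N : A} (hN : M N) {i c : ℕ} (hi : 1 ≤ i)
    (hc : i + n = c) (hd : c ≤ d) (x : Ext.{w} N Y i) (hx : x.comp ε hc = 0) : x = 0 := by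
  induction h generalizing c with
  | zero e =>
    obtain rfl : i = c := hc
    rw [← Ext.comp_mk₀_id x, ← e.inv_hom_id, ← Ext.mk₀_comp_mk₀,
      ← Ext.comp_assoc_of_third_deg_zero, hx, Ext.zero_comp]
  | @succ n Y S hS hP ε _ ih =>
    rw [← Ext.comp_assoc (h₁₂ := rfl) (h := by lia)] at hx
    obtain ⟨y, hy⟩ := Ext.covariant_sequence_exact₃ N hS _ (by lia) hx
    refine ih rfl (by lia) x ?_
    rw [← hy, hM.ext_eq_zero hN hP (by lia) (by lia) y, Ext.zero_comp]

include hM in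
/-- A morphism to an object of `M` kills the class if and only if it extends to the first middle
term. -/
lemma exists_first {ε : Ext.{w} Y X (n + 1)} (h : Splice P (n + 1) X Y ε) (hP : P ≤ M)
    (hd : n + 1 ≤ d) :
    ∃ (E : A) (j : X ⟶ E), P E ∧ Mono j ∧ ε.comp (Ext.mk₀ j) (add_zero _) = 0 ∧
      ∀ (N : A), M N → ∀ u : X ⟶ N, ε.comp (Ext.mk₀ u) (add_zero _) = 0 → ∃ v, j ≫ v = u := by
  obtain - | ⟨S, hS, hE, ε', h⟩ := h
  refine ⟨S.X₂, S.f, hE, hS.mono_f, ?_, ?_⟩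
  · rw [Ext.comp_assoc (h := by lia) (h₂₃ := add_zero 1), hS.extClass_comp, Ext.comp_zero]
  · intro N hN u hu
    rw [Ext.comp_assoc (h := by lia) (h₂₃ := add_zero 1)] at hu
    have h0 := (h.mono hP).eq_zero_of_comp_left hM hN le_rfl rfl hd _ hu
    obtain ⟨y, hy⟩ := Ext.contravariant_sequence_exact₁ hS N _ _ h0
    obtain ⟨v, rfl⟩ := (Ext.mk₀_bijective _ _).2 y
    exact ⟨v, (Ext.mk₀_bijective _ _).1 (by simpa using hy)⟩

include hM in
-- Exactness at the other end of the splice: classes on `Y` killed by the last map are multiples of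
-- `ε`. The degree `m` is left free because each step of the induction produces a factor of degree
-- one higher.
lemma exists_comp_eq_of_last {ε : Ext.{w} Y X (n + 1)} (h : Splice P (n + 1) X Y ε)
    (hP : P ≤ M) :
    ∃ (E : A) (q : E ⟶ Y), P E ∧ Epi q ∧ (Ext.mk₀ q).comp ε (zero_add _) = 0 ∧
      ∀ (N : A), M N → ∀ (m k : ℕ) (hk : n + 1 + m = k), k ≤ d → ∀ y : Ext.{w} Y N k,
        (Ext.mk₀ q).comp y (zero_add _) = 0 → ∃ x : Ext.{w} X N m, ε.comp x hk = y := by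
  induction n generalizing X with
  | zero =>
    obtain - | ⟨S, hS, hE, ε', h⟩ := h
    obtain ⟨e⟩ := h
    have := hS.epi_g
    refine ⟨S.X₂, S.g ≫ e.hom, hE, inferInstance, by simp, ?_⟩
    intro N hN m k hk hd y hy
    rw [← Ext.mk₀_comp_mk₀_assoc] at hy
    obtain ⟨x, hx⟩ := Ext.contravariant_sequence_exact₃ hS N _ hy (n₀ := m) (by lia)
    refine ⟨x, ?_⟩
    rw [Ext.comp_assoc (h := by lia) (h₂₃ := show 1 + m = k by lia), hx]
    simp
  | succ n ih =>
    obtain - | ⟨S, hS, hE, ε', h⟩ := h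
    obtain ⟨E, q, hE', hq, h0, H⟩ := ih h
    refine ⟨E, q, hE', hq, ?_, ?_⟩
    · rw [← Ext.comp_assoc (h₁₂ := zero_add _) (h := by lia), h0, Ext.zero_comp]
    · intro N hN m k hk hd y hy
      obtain ⟨x', rfl⟩ := H N hN (m + 1) k (by lia) hd y hy
      obtain ⟨x, rfl⟩ := Ext.contravariant_sequence_exact₃ hS N x'
        (hM.ext_eq_zero (hP _ hE) hN (by lia) (by lia) _) (add_comm 1 m)
      exact ⟨x, by rw [Ext.comp_assoc (h := by lia)]⟩

include hM in
-- The middle terms have no Ext from `N` in degrees `1, …, d - 1`, so a class of degree `n < d`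
-- descends along the connecting maps to a morphism into `Y`.
lemma exists_mk₀_comp_eq (h : Splice M n X Y ε) {N : A} (hN : M N) (hd : n + 1 ≤ d)
    (η : Ext.{w} N X n) : ∃ φ : N ⟶ Y, (Ext.mk₀ φ).comp ε (zero_add n) = η := by
  induction h with
  | zero e =>
    obtain ⟨φ, rfl⟩ := (Ext.mk₀_bijective _ _).2 η
    exact ⟨φ ≫ e.hom, by simp⟩
  | @succ n Y S hS hP ε _ ih =>
    obtain ⟨η', rfl⟩ := Ext.covariant_sequence_exact₁ N hS η
      (hM.ext_eq_zero hN hP (by lia) (by lia) _) rfl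
    obtain ⟨φ, rfl⟩ := ih (by lia) η'
    exact ⟨φ, by rw [Ext.comp_assoc (h := by lia)]⟩

include hM in
/-- A class killed by a morphism through which the splice starts is a pullback of the splice. -/
lemma exists_mk₀_comp_eq_of_first {S : ShortComplex A} (hS : S.ShortExact)
    {ε : Ext.{w} Y S.X₃ n} (h : Splice M n S.X₃ Y ε) {N : A} (hN : M N) (hd : n + 1 ≤ d)
    (η : Ext.{w} N S.X₁ (n + 1)) (hη : η.comp (Ext.mk₀ S.f) (add_zero _) = 0) :
    ∃ φ : N ⟶ Y, (Ext.mk₀ φ).comp (ε.comp hS.extClass rfl) (zero_add (n + 1)) = η := by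
  obtain ⟨η', rfl⟩ := Ext.covariant_sequence_exact₁ N hS η hη rfl
  obtain ⟨φ, rfl⟩ := h.exists_mk₀_comp_eq hM hN hd η'
  exact ⟨φ, by rw [Ext.comp_assoc (h := by lia)]⟩

include hM in
lemma ext_eq_zero_left (h : Splice M n X Y ε) (hY : M Y) {N : A} (hN : M N) {i : ℕ} (hi : 1 ≤ i)
    (hd : i + n < d) (x : Ext.{w} X N i) : x = 0 := by
  induction h generalizing i with
  | zero e =>
    rw [← Ext.mk₀_id_comp x, ← e.hom_inv_id, ← Ext.mk₀_comp_mk₀_assoc,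
      hM.ext_eq_zero hY hN hi (by lia) ((Ext.mk₀ e.inv).comp x _), Ext.comp_zero]
  | @succ n Y S hS hP ε _ ih =>
    obtain ⟨y, rfl⟩ := Ext.contravariant_sequence_exact₁ hS N x (add_comm 1 i)
      (ih hY (by lia) (by lia) _)
    rw [hM.ext_eq_zero hP hN hi (by lia) y, Ext.comp_zero]

end Splice

end HigherExt

/-! ### Realising classes of degree `d` by sequences in a cluster tilting subcategory -/

namespace HigherExt

lemma IsLeftApproximation.mono {A : Type u} [Category.{v} A] {M : ObjectProperty A}
    (hM : IsCogenerating M) {Y X : A} {f : Y ⟶ X} (hf : IsLeftApproximation M f) : Mono f := by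
  obtain ⟨Z, i, hZ, hi⟩ := hM Y
  obtain ⟨h, rfl⟩ := hf.2 Z hZ i
  exact mono_of_mono f h

variable {A : Type u} [Category.{v} A] [Abelian A] [HasExt.{w} A] {M : ObjectProperty A} {d : ℕ}

/-- In degree one, `B` is the middle term of an extension. In higher degree, cover `K` by an object
of `M` that effaces `ε` and pass to the kernel; the vanishing of Ext on this cover ensures that the
same morphisms kill the class. The object `B` need not lie in `M`. -/
lemma IsClusterTilting.exists_mono_extends_iff (hM : IsClusterTilting.{w} d M) {n : ℕ}
    (hn : n + 1 ≤ d) {K X : A} (ε : Ext.{w} K X (n + 1)) :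
    ∃ (B : A) (i : X ⟶ B), Mono i ∧ ∀ (N : A), M N → ∀ u : X ⟶ N,
      ε.comp (Ext.mk₀ u) (add_zero _) = 0 ↔ ∃ v, i ≫ v = u := by
  induction n generalizing K with
  | zero =>
    obtain ⟨B, i, g, w, hS, rfl⟩ := exists_shortExact_extClass_eq ε
    refine ⟨B, i, hS.mono_f, fun N hN u => ⟨fun hu => ?_, ?_⟩⟩
    · obtain ⟨y, hy⟩ := Ext.contravariant_sequence_exact₁ hS N _ _ hu
      obtain ⟨v, rfl⟩ := (Ext.mk₀_bijective _ _).2 y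
      exact ⟨v, (Ext.mk₀_bijective _ _).1 (by simpa using hy)⟩
    · rintro ⟨v, rfl⟩
      have := hS.extClass_comp_assoc (Ext.mk₀ v) (h := add_zero 1)
      simpa using this
  | succ n ih =>
    obtain ⟨P, p, hp, h⟩ := exists_epi_comp_eq_zero ε
    obtain ⟨P', q, hP', hq⟩ := hM.generating P
    have hqp : (Ext.mk₀ (q ≫ p)).comp ε (zero_add _) = 0 := by
      rw [← Ext.mk₀_comp_mk₀_assoc, h, Ext.comp_zero]
    obtain ⟨ε', rfl⟩ := Ext.contravariant_sequence_exact₃ (shortExact_kernel (q ≫ p)) X ε hqp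
      (add_comm 1 (n + 1))
    obtain ⟨B, i, hi, H⟩ := ih (by lia) ε'
    refine ⟨B, i, hi, fun N hN u => ?_⟩
    rw [← H N hN, Ext.comp_assoc_of_third_deg_zero]
    refine ⟨fun h0 => ?_, fun h0 => by rw [h0, Ext.comp_zero]⟩
    obtain ⟨y, hy⟩ := Ext.contravariant_sequence_exact₁ (shortExact_kernel (q ≫ p)) N _ _ h0
    rw [← hy, hM.ext_eq_zero hP' hN (by lia) (by lia) y, Ext.comp_zero]

/-- The hypotheses say that `C` has Ext into `M` only in degree `d - (n + 1)`, where `y` detects it.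
The cokernel of a left approximation of `C` inherits them with `n` lowered by one: its Ext in degree
one vanishes by the approximation property, the rest by shifting. For `n = 0` they force the middle
term into `M`. -/
lemma IsClusterTilting.splice_of_ext_eq_zero (hM : IsClusterTilting.{w} d M) {n : ℕ}
    (hn : n + 2 ≤ d) {C Y : A} (hY : M Y) (y : Ext.{w} Y C (n + 1))
    (h₁ : ∀ (N : A), M N → ∀ i, 1 ≤ i → i < d → i + (n + 1) ≠ d → ∀ z : Ext.{w} C N i, z = 0)
    (h₂ : ∀ (N : A), M N → ∀ i (hi : n + 1 + i = d) (z : Ext.{w} C N i), y.comp z hi = 0 → z = 0) :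
    Splice M (n + 1) C Y y := by
  induction n generalizing C with
  | zero =>
    obtain ⟨E, f, g, w, hS, rfl⟩ := exists_shortExact_extClass_eq y
    have hE : M E := by
      refine (hM.mem_iff_ext_left E).2 fun N hN i hi hd => subsingleton_of_forall_eq 0 fun e => ?_
      have h0 : (Ext.mk₀ f).comp e (zero_add i) = 0 := by
        by_cases h : i + 1 = d
        · exact h₂ N hN i (by lia) _ (hS.extClass_comp_assoc e)
        · exact h₁ N hN i hi hd h _
      obtain ⟨e', rfl⟩ := Ext.contravariant_sequence_exact₂ hS N e h0
      rw [hM.ext_eq_zero hY hN hi hd e', Ext.comp_zero]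
    have := Splice.succ _ hS hE _ (.zero (Iso.refl _))
    rwa [Iso.refl_inv, Ext.mk₀_id_comp] at this
  | succ n ih =>
    obtain ⟨B, j, hj⟩ := hM.functoriallyFinite.covariantly C
    have := hj.mono hM.cogenerating
    have hS := shortExact_cokernel j
    obtain ⟨y', rfl⟩ := Ext.covariant_sequence_exact₁ Y hS y
      (hM.ext_eq_zero hY hj.1 (by lia) (by lia) _) rfl
    have key (N : A) (hN : M N) (i : ℕ) (hi : i + 1 < d) (z : Ext.{w} (cokernel j) N (i + 1)) :
        ∃ z' : Ext.{w} C N i, hS.extClass.comp z' (add_comm 1 i) = z :=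
      Ext.contravariant_sequence_exact₃ hS N z (hM.ext_eq_zero hj.1 hN (by lia) hi _) _
    refine Splice.succ _ hS hj.1 y' (ih (by lia) y' ?_ ?_)
    · rintro N hN (- | - | i) h1 hd hi z
      · lia
      · obtain ⟨z', rfl⟩ := key N hN 0 hd z
        obtain ⟨u, rfl⟩ := (Ext.mk₀_bijective _ _).2 z'
        obtain ⟨v, rfl⟩ := hj.2 N hN u
        have := hS.extClass_comp_assoc (Ext.mk₀ v) (h := add_zero 1)
        simpa using this
      · obtain ⟨z', rfl⟩ := key N hN (i + 1) hd z
        rw [h₁ N hN (i + 1) (by lia) (by lia) (by lia) z', Ext.comp_zero]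
    · rintro N hN (- | i) hi z hz
      · lia
      · obtain ⟨z', rfl⟩ := key N hN i (by lia) z
        rw [h₂ N hN i (by lia) z' ?_, Ext.comp_zero]
        rw [Ext.comp_assoc (h := by lia)]
        exact hz

/-- Every class in degree `d` between objects of `M` is the class of a sequence in `M`. -/
theorem IsClusterTilting.splice (hM : IsClusterTilting.{w} d M) (hd : 1 ≤ d) {X Y : A}
    (hX : M X) (hY : M Y) (ε : Ext.{w} Y X d) : Splice M d X Y ε := by
  obtain - | - | d := d
  · lia
  · obtain ⟨E, f, g, w, hS, rfl⟩ := exists_shortExact_extClass_eq ε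
    have hE : M E := (hM.mem_iff_ext_left E).2 fun N hN i h1 h2 => by lia
    have := Splice.succ _ hS hE _ (.zero (Iso.refl _))
    rwa [Iso.refl_inv, Ext.mk₀_id_comp] at this
  · obtain ⟨B₀, i, hi, H⟩ := hM.exists_mono_extends_iff (by lia) ε
    -- Replacing `B₀` by its approximation does not change which morphisms from `X` to objects of
    -- `M` extend.
    obtain ⟨B, j, hj⟩ := hM.functoriallyFinite.covariantly B₀
    have := hj.mono hM.cogenerating
    have hS := shortExact_cokernel (i ≫ j)
    obtain ⟨η, rfl⟩ := Ext.covariant_sequence_exact₁ Y hS ε ((H B hj.1 _).2 ⟨j, rfl⟩) rfl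
    have key (N : A) (hN : M N) (k : ℕ) (hk : k + 1 < d + 2)
        (z : Ext.{w} (cokernel (i ≫ j)) N (k + 1)) :
        ∃ z' : Ext.{w} X N k, hS.extClass.comp z' (add_comm 1 k) = z :=
      Ext.contravariant_sequence_exact₃ hS N z (hM.ext_eq_zero hj.1 hN (by lia) hk _) _
    -- The cokernel has Ext into `M` only in degree one, where it measures the failure of morphisms
    -- `X ⟶ N` to extend; by the choice of `B₀` this failure is detected by `ε`.
    refine Splice.succ _ hS hj.1 η (hM.splice_of_ext_eq_zero (by lia) hY η ?_ ?_)
    · rintro N hN (- | - | k) h1 hd hi z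
      · lia
      · lia
      · obtain ⟨z', rfl⟩ := key N hN (k + 1) hd z
        rw [hM.ext_eq_zero hX hN (by lia) (by lia) z', Ext.comp_zero]
    · intro N hN k hk z hz
      obtain rfl : k = 1 := by lia
      obtain ⟨z', rfl⟩ := key N hN 0 (by lia) z
      obtain ⟨u, rfl⟩ := (Ext.mk₀_bijective _ _).2 z'
      obtain ⟨v, rfl⟩ := (H N hN u).1 (by rwa [Ext.comp_assoc (h := by lia)])
      obtain ⟨v, rfl⟩ := hj.2 N hN v
      have := hS.extClass_comp_assoc (Ext.mk₀ v) (h := add_zero 1)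
      simpa using this

end HigherExt

/-! ### Classes of coresolutions and lifting of morphisms -/

namespace HigherExt

variable {A : Type u} [Category.{v} A] [Abelian A] [HasExt.{w} A]

/-- `Resolves F i ε` says that `0 ⟶ X ⟶ F₀ ⟶ F₁ ⟶ ⋯ ⟶ Fₙ ⟶ 0` is exact, where the first map
is `i`, and that its class is `ε`. -/
def Resolves : ∀ {n : ℕ} (F : ComposableArrows A n) {X : A} (_ : X ⟶ F.left)
    (_ : Ext.{w} F.right X n), Prop
  | 0, F, X, i, ε => ∃ e : X ≅ F.left, e.hom = i ∧ ε = Ext.mk₀ e.inv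
  | n + 1, F, X, i, ε => ∃ (C : A) (q : F.left ⟶ C) (i' : C ⟶ F.obj' 1) (w : i ≫ q = 0)
      (hS : (ShortComplex.mk i q w).ShortExact) (ε' : Ext.{w} F.right C n),
      q ≫ i' = F.map' 0 1 ∧ Resolves (n := n) F.δ₀ i' ε' ∧ ε = ε'.comp hS.extClass rfl

namespace Resolves

variable {P M : ObjectProperty A} {d : ℕ}

lemma splice {n : ℕ} {F : ComposableArrows A n} {X : A} {i : X ⟶ F.left}
    {ε : Ext.{w} F.right X n} (h : Resolves F i ε) (hP : ∀ k (hk : k < n), P (F.obj' k)) :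
    Splice P n X F.right ε := by
  induction n generalizing X with
  | zero =>
    obtain ⟨e, rfl, rfl⟩ := h
    exact .zero e
  | succ n ih =>
    obtain ⟨C, q, i', w, hS, ε', -, h, rfl⟩ := h
    exact .succ _ hS (hP 0 (by lia)) ε' (ih h fun k hk => hP (k + 1) (by lia))

lemma _root_.HigherExt.Splice.exists_resolves {n : ℕ} {X Y : A} {ε : Ext.{w} Y X n}
    (h : Splice P n X Y ε) :
    ∃ (F : ComposableArrows A n) (i : X ⟶ F.left) (r : F.right ≅ Y),
      Resolves F i ((Ext.mk₀ r.hom).comp ε (zero_add n)) ∧ ∀ k (hk : k < n), P (F.obj' k) := by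
  induction h with
  | @zero X Y e =>
    exact ⟨ComposableArrows.mk₀ Y, e.hom, Iso.refl _, ⟨e, rfl, Ext.mk₀_id_comp _⟩,
      fun k hk => by lia⟩
  | @succ n Y S hS hP ε h ih =>
    obtain ⟨F, i, r, hF, hF'⟩ := ih
    refine ⟨F.precomp (S.g ≫ i), S.f, r, ⟨S.X₃, S.g, i, S.zero, hS, _, rfl, hF, ?_⟩, ?_⟩
    · exact (Ext.comp_assoc (h₁₂ := zero_add n) (h := by lia) ..).symm
    · rintro (- | k) hk
      · exact hP
      · exact hF' k (by lia)

lemma naturality {n : ℕ} {F F' : ComposableArrows A n} {X X' : A} {i : X ⟶ F.left}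
    {i' : X' ⟶ F'.left} {ε : Ext.{w} F.right X n} {ε' : Ext.{w} F'.right X' n}
    (h : Resolves F i ε) (h' : Resolves F' i' ε') (φ : F ⟶ F') (u : X ⟶ X')
    (hu : i ≫ ComposableArrows.app' φ 0 = u ≫ i') :
    ε.comp (Ext.mk₀ u) (add_zero n) =
      (Ext.mk₀ (ComposableArrows.app' φ n)).comp ε' (zero_add n) := by
  induction n generalizing X X' with
  | zero =>
    obtain ⟨e, rfl, rfl⟩ := h
    obtain ⟨e', rfl, rfl⟩ := h'
    rw [Ext.mk₀_comp_mk₀]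
    refine Eq.trans ?_ (Ext.mk₀_comp_mk₀ _ _).symm
    congr 1
    rw [Iso.inv_comp_eq, ← Category.assoc, Iso.eq_comp_inv]
    exact hu.symm
  | succ n ih =>
    obtain ⟨C, q, j, w, hS, ε, hq, h, rfl⟩ := h
    obtain ⟨C', q', j', w', hS', ε', hq', h', rfl⟩ := h'
    have := hS.epi_g
    have w₂ : i ≫ ComposableArrows.app' φ 0 ≫ q' = 0 := by
      rw [← Category.assoc, hu, Category.assoc, w', comp_zero]
    let c : C ⟶ C' := hS.exact.desc (ComposableArrows.app' φ 0 ≫ q') w₂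
    have hc : q ≫ c = ComposableArrows.app' φ 0 ≫ q' := hS.exact.g_desc _ _
    have nat := hS.extClass_naturality hS'
      { τ₁ := u, τ₂ := ComposableArrows.app' φ 0, τ₃ := c, comm₁₂ := hu.symm, comm₂₃ := hc.symm }
    have hj : j ≫ ComposableArrows.app' φ 1 = c ≫ j' := by
      have : Epi q := hS.epi_g
      rw [← cancel_epi q, ← Category.assoc, hq, ← Category.assoc, hc, Category.assoc, hq']
      exact ComposableArrows.naturality' φ 0 1
    have key : ε.comp (Ext.mk₀ c) (add_zero n) =
        (Ext.mk₀ (ComposableArrows.app' φ (n + 1))).comp ε' (zero_add n) :=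
      ih h h' (ComposableArrows.δ₀Functor.map φ) c hj
    dsimp only at nat
    rw [Ext.comp_assoc_of_third_deg_zero, nat, ← Ext.comp_assoc (h₁₂ := add_zero n) (h := by lia),
      key, Ext.comp_assoc (h₂₃ := rfl) (h := by lia)]

/-- Converse to `naturality`: compatibility of the classes is the only obstruction to extending maps
of end terms to a morphism of sequences. -/
lemma exists_hom (hM : IsClusterTilting.{w} d M) {n : ℕ} (hn : n ≤ d)
    {F F' : ComposableArrows A n} {X X' : A} {i : X ⟶ F.left}
    {i' : X' ⟶ F'.left} {ε : Ext.{w} F.right X n} {ε' : Ext.{w} F'.right X' n}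
    (h : Resolves F i ε) (h' : Resolves F' i' ε') (hF : ∀ k, M (F.obj k)) (hF' : ∀ k, M (F'.obj k))
    (u : X ⟶ X') (g : F.right ⟶ F'.right)
    (hug : ε.comp (Ext.mk₀ u) (add_zero n) = (Ext.mk₀ g).comp ε' (zero_add n)) :
    ∃ φ : F ⟶ F', i ≫ ComposableArrows.app' φ 0 = u ≫ i' ∧ ComposableArrows.app' φ n = g := by
  induction n generalizing X X' with
  | zero =>
    obtain ⟨e, rfl, rfl⟩ := h
    obtain ⟨e', rfl, rfl⟩ := h'
    refine ⟨ComposableArrows.homMk₀ g, ?_, rfl⟩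
    have hug' : Ext.mk₀ (e.inv ≫ u) = Ext.mk₀ (g ≫ e'.inv) := by
      rw [← Ext.mk₀_comp_mk₀, hug]
      exact Ext.mk₀_comp_mk₀ _ _
    have h0 := (Ext.mk₀_bijective _ _).1 hug'
    rw [Iso.inv_comp_eq, ← Category.assoc, Iso.eq_comp_inv] at h0
    exact h0.symm
  | succ n ih =>
    obtain ⟨C, q, j, w, hS, ε, hq, h, rfl⟩ := h
    obtain ⟨C', q', j', w', hS', ε', hq', h', rfl⟩ := h'
    have hsp : Splice M n C F.right ε := h.splice (P := M) fun k hk => hF ⟨k + 1, by lia⟩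
    have h0 : hS.extClass.comp (Ext.mk₀ (u ≫ i')) (add_zero 1) = 0 := by
      refine hsp.eq_zero_of_comp_left hM (N := F'.left) (hF' 0) le_rfl rfl hn _ ?_
      rw [← Ext.comp_assoc (h₁₂ := rfl) (h := by lia), ← Ext.mk₀_comp_mk₀,
        ← Ext.comp_assoc_of_third_deg_zero, hug, Ext.comp_assoc_of_third_deg_zero,
        Ext.comp_assoc_of_third_deg_zero, hS'.extClass_comp, Ext.comp_zero, Ext.comp_zero]
    obtain ⟨y, hy⟩ := Ext.contravariant_sequence_exact₁ hS _ _ (add_zero 1) h0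
    obtain ⟨e, rfl⟩ := (Ext.mk₀_bijective _ _).2 y
    have he : i ≫ e = u ≫ i' := (Ext.mk₀_bijective _ _).1 (by simpa using hy)
    have w₂ : i ≫ e ≫ q' = 0 := by
      rw [← Category.assoc, he, Category.assoc, w', comp_zero]
    have hqe : Epi q := hS.epi_g
    obtain ⟨c, hc⟩ : ∃ c : C ⟶ C', q ≫ c = e ≫ q' := ⟨_, hS.exact.g_desc (e ≫ q') w₂⟩
    have nat := hS.extClass_naturality hS'
      { τ₁ := u, τ₂ := e, τ₃ := c, comm₁₂ := he.symm, comm₂₃ := hc.symm }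
    dsimp only at nat
    -- The classes for `c` and `g` agree only after applying the connecting map, so they differ by a
    -- class with values in `F'.left`. It vanishes in positive degree; in degree zero it is absorbed
    -- by changing `c` and `e` by `t`.
    obtain ⟨x, hx⟩ := Ext.covariant_sequence_exact₃ F.right hS'
      (ε.comp (Ext.mk₀ c) (add_zero n) - (Ext.mk₀ g).comp ε' (zero_add n)) rfl (by
        rw [sub_eq_add_neg, Ext.add_comp, Ext.neg_comp, Ext.comp_assoc_of_second_deg_zero, ← nat,
          ← Ext.comp_assoc_of_third_deg_zero, hug, Ext.comp_assoc (h₂₃ := rfl) (h := by lia),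
          add_neg_cancel])
    obtain ⟨t, rfl⟩ : ∃ t : C ⟶ F'.left, ε.comp (Ext.mk₀ t) (add_zero n) = x := by
      obtain - | n := n
      · obtain ⟨r, -, rfl⟩ := h
        obtain ⟨x, rfl⟩ := (Ext.mk₀_bijective _ _).2 x
        exact ⟨r.hom ≫ x, (Ext.mk₀_comp_mk₀ _ _).trans (congrArg _ (r.inv_hom_id_assoc x))⟩
      · exact ⟨0, by rw [hM.ext_eq_zero (hF _) (hF' _) (by lia) (by lia) x, Ext.mk₀_zero,
          Ext.comp_zero]⟩
    have hc' : q ≫ (c - t ≫ q') = (e - q ≫ t) ≫ q' := by simp [hc]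
    have hg : ε.comp (Ext.mk₀ (c - t ≫ q')) (add_zero n) = (Ext.mk₀ g).comp ε' (zero_add n) := by
      rw [sub_eq_add_neg, Ext.mk₀_add, Ext.mk₀_neg, Ext.comp_add, Ext.comp_neg,
        ← Ext.mk₀_comp_mk₀, ← Ext.comp_assoc_of_third_deg_zero, hx]
      abel
    have hw (x : F.obj' 1 ⟶ F'.obj' 1) (hx : j ≫ x = (c - t ≫ q') ≫ j') :
        F.map' 0 1 ≫ x = (e - q ≫ t) ≫ F'.map' 0 1 := by
      rw [← hq, ← hq', Category.assoc, hx, ← Category.assoc, hc', Category.assoc]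
    obtain ⟨ψ, hψ, hψ'⟩ := ih (by lia) h h' (fun k => hF k.succ) (fun k => hF' k.succ)
      (c - t ≫ q') g hg
    refine ⟨ComposableArrows.homMkSucc (e - q ≫ t) ψ (hw _ hψ), ?_, hψ'⟩
    change i ≫ (e - q ≫ t) = _
    rw [Preadditive.comp_sub, ← Category.assoc i, w, zero_comp, sub_zero, he]

end Resolves

end HigherExt

/-! ### Exactness in the abelian category versus `d`-kernels and `d`-cokernels -/

namespace HigherExt

variable {A : Type u} [Category.{v} A] [Abelian A] [HasExt.{w} A]

namespace Resolves

variable {P M : ObjectProperty A} {d : ℕ}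

lemma mono {n : ℕ} {F : ComposableArrows A n} {X : A} {i : X ⟶ F.left}
    {ε : Ext.{w} F.right X n} (h : Resolves F i ε) : Mono i := by
  obtain - | n := n
  · obtain ⟨e, rfl, -⟩ := h
    infer_instance
  · obtain ⟨C, q, j, w, hS, -⟩ := h
    exact hS.mono_f

lemma epi {n : ℕ} {F : ComposableArrows A n} {X : A} {i : X ⟶ F.left}
    {ε : Ext.{w} F.right X n} (h : Resolves F i ε) :
    Epi ((F.precomp i).map' n (n + 1)) := by
  induction n generalizing X with
  | zero =>
    obtain ⟨e, rfl, -⟩ := h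
    change Epi e.hom
    infer_instance
  | succ n ih =>
    obtain ⟨C, q, j, w, hS, ε', hq, h, rfl⟩ := h
    have hj := ih h
    obtain - | n := n
    · change Epi (F.map' 0 1)
      change Epi j at hj
      rw [← hq]
      have : Epi q := hS.epi_g
      infer_instance
    · exact hj

lemma comp_eq_zero {n : ℕ} {F : ComposableArrows A n} {X : A} {i : X ⟶ F.left}
    {ε : Ext.{w} F.right X n} (h : Resolves F i ε) (k : ℕ) (hk : k < n) :
    (F.precomp i).map' k (k + 1) ≫ (F.precomp i).map' (k + 1) (k + 2) = 0 := by
  induction n generalizing X k with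
  | zero => lia
  | succ n ih =>
    obtain ⟨C, q, j, w, hS, ε', hq, h, rfl⟩ := h
    obtain - | - | k := k
    · change i ≫ F.map' 0 1 = 0
      rw [← hq, ← Category.assoc, w, zero_comp]
    · have h0 : j ≫ F.map' 1 2 = 0 := ih h 0 (by lia)
      change F.map' 0 1 ≫ F.map' 1 2 = 0
      rw [← hq, Category.assoc, h0, comp_zero]
    · exact ih h (k + 1) (by lia)

lemma exists_extension (hM : IsClusterTilting.{w} d M) {n : ℕ} {F : ComposableArrows A n} {X : A}
    {i : X ⟶ F.left} {ε : Ext.{w} F.right X n} (h : Resolves F i ε) (hn : n < d)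
    (hF : ∀ k, M (F.obj k)) {N : A} (hN : M N) (t : X ⟶ N) : ∃ s, i ≫ s = t := by
  obtain - | n := n
  · obtain ⟨e, rfl, -⟩ := h
    exact ⟨e.inv ≫ t, by simp⟩
  · obtain ⟨C, q, j, w, hS, ε', hq, h, rfl⟩ := h
    have hsp : Splice M n C F.right ε' := h.splice (P := M) fun k hk => hF ⟨k + 1, by lia⟩
    obtain ⟨y, hy⟩ := Ext.contravariant_sequence_exact₁ hS _ (Ext.mk₀ t) (add_zero 1)
      (hsp.ext_eq_zero_left hM (hF _) hN le_rfl (by lia) _)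
    obtain ⟨s, rfl⟩ := (Ext.mk₀_bijective _ _).2 y
    exact ⟨s, (Ext.mk₀_bijective _ _).1 (by simpa using hy)⟩

lemma exists_desc (hM : IsClusterTilting.{w} d M) {n : ℕ} {F : ComposableArrows A n} {X : A}
    {i : X ⟶ F.left} {ε : Ext.{w} F.right X n} (h : Resolves F i ε) (hn : n ≤ d)
    (hF : ∀ k, M (F.obj k)) {N : A} (hN : M N) (k : ℕ) (hk : k < n)
    (t : (F.precomp i).obj' (k + 1) ⟶ N) (ht : (F.precomp i).map' k (k + 1) ≫ t = 0) :
    ∃ s : (F.precomp i).obj' (k + 2) ⟶ N, (F.precomp i).map' (k + 1) (k + 2) ≫ s = t := by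
  induction n generalizing X k with
  | zero => lia
  | succ n ih =>
    obtain ⟨C, q, j, w, hS, ε', hq, h, rfl⟩ := h
    have hqe : Epi q := hS.epi_g
    have := hS.epi_g
    obtain - | - | k := k
    · change F.left ⟶ N at t
      change i ≫ t = 0 at ht
      obtain ⟨r, hr⟩ := h.exists_extension hM (by lia) (fun k => hF k.succ) hN (hS.exact.desc t ht)
      change F.obj' 1 ⟶ N at r
      refine ⟨r, ?_⟩
      have hr' : q ≫ j ≫ r = t := (congrArg (q ≫ ·) hr).trans (hS.exact.g_desc _ _)
      change F.map' 0 1 ≫ r = t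
      rw [← hq, Category.assoc, hr']
    · change F.obj' 1 ⟶ N at t
      refine ih h (by lia) (fun k => hF k.succ) 0 (by lia) t ?_
      change j ≫ t = 0
      change F.map' 0 1 ≫ t = 0 at ht
      rw [← cancel_epi q, ← Category.assoc, hq, ht, comp_zero]
    · exact ih h (by lia) (fun k => hF k.succ) (k + 1) (by lia) t ht

/-- Vanishing of Ext is assumed in place of membership of `X` in `M`, because the induction passes
to cosyzygies `C` outside `M`, losing one degree each time. -/
lemma exists_lift (hM : IsClusterTilting.{w} d M) {n : ℕ} {F : ComposableArrows A n} {X : A}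
    {i : X ⟶ F.left} {ε : Ext.{w} F.right X n} (h : Resolves F i ε) (hn : n ≤ d)
    (hF : ∀ k, M (F.obj k)) {N : A} (hN : M N)
    (hX : ∀ k, 1 ≤ k → k < n → ∀ x : Ext.{w} N X k, x = 0) (k : ℕ) (hk : k < n)
    (t : N ⟶ (F.precomp i).obj' (k + 1)) (ht : t ≫ (F.precomp i).map' (k + 1) (k + 2) = 0) :
    ∃ s : N ⟶ (F.precomp i).obj' k, s ≫ (F.precomp i).map' k (k + 1) = t := by
  induction n generalizing X k with
  | zero => lia
  | succ n ih =>
    obtain ⟨C, q, j, w, hS, ε', hq, h, rfl⟩ := h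
    have hi : Mono i := hS.mono_f
    have := hS.mono_f
    have hj : Mono j := h.mono
    obtain - | k := k
    · change N ⟶ F.left at t
      change t ≫ F.map' 0 1 = 0 at ht
      have ht' : t ≫ q = 0 := by
        rw [← cancel_mono j, Category.assoc, hq, ht, zero_comp]
      exact ⟨hS.exact.lift t ht', hS.exact.lift_f _ _⟩
    · have hC : ∀ k, 1 ≤ k → k < n → ∀ x : Ext.{w} N C k, x = 0 := by
        intro k h1 h2 x
        obtain ⟨y, rfl⟩ := Ext.covariant_sequence_exact₃ N hS x rfl (hX _ (by lia) (by lia) _)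
        rw [hM.ext_eq_zero (N := F.left) hN (hF 0) h1 (by lia) y, Ext.zero_comp]
      obtain ⟨s, hs⟩ := ih h (by lia) (fun k => hF k.succ) hC k (by lia) t ht
      obtain - | k := k
      · change N ⟶ C at s
        change N ⟶ F.obj' 1 at t
        change s ≫ j = t at hs
        obtain ⟨y, hy⟩ := Ext.covariant_sequence_exact₃ N hS (Ext.mk₀ s) rfl
          (hX _ (by lia) (by lia) _)
        obtain ⟨r, rfl⟩ := (Ext.mk₀_bijective _ _).2 y
        have hr : r ≫ q = s := (Ext.mk₀_bijective _ _).1 (by simpa using hy)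
        refine ⟨r, ?_⟩
        change r ≫ F.map' 0 1 = t
        rw [← hq, ← Category.assoc, hr, hs]
      · exact ⟨s, hs⟩

lemma isDCokernel (hM : IsClusterTilting.{w} d M) {F : ComposableArrows A d} {X : A}
    {i : X ⟶ F.left} {ε : Ext.{w} F.right X d} (h : Resolves F i ε)
    (hF : ∀ k, M (F.obj k)) (hX : M X) : IsDCokernel M (F.precomp i) where
  mem := by
    rintro ⟨- | k, hk⟩
    · exact hX
    · exact hF ⟨k, by lia⟩
  injective N hN := by
    have := h.epi
    intro a b hab
    exact (cancel_epi _).1 hab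
  exact N hN k hk t := by
    refine ⟨fun ht => h.exists_desc hM le_rfl hF hN k hk t ht, ?_⟩
    rintro ⟨s, rfl⟩
    dsimp only
    rw [← Category.assoc, h.comp_eq_zero k hk, zero_comp]

lemma isDKernel (hM : IsClusterTilting.{w} d M) {F : ComposableArrows A d} {X : A}
    {i : X ⟶ F.left} {ε : Ext.{w} F.right X d} (h : Resolves F i ε)
    (hF : ∀ k, M (F.obj k)) (hX : M X) : IsDKernel M (F.precomp i) where
  mem := (h.isDCokernel hM hF hX).mem
  injective N hN := by
    have := h.mono
    intro a b hab
    exact (cancel_mono i).1 hab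
  exact N hN k hk t := by
    refine ⟨fun ht => h.exists_lift hM le_rfl hF hN
      (fun k h1 h2 x => hM.ext_eq_zero hN hX h1 h2 x) k hk t ht, ?_⟩
    rintro ⟨s, rfl⟩
    dsimp only
    rw [Category.assoc, h.comp_eq_zero k hk, comp_zero]

lemma exists_of_exact {n : ℕ} (F : ComposableArrows A n) {X : A} (i : X ⟶ F.left) [hi : Mono i]
    (hF : (F.precomp i).Exact) (he : Epi ((F.precomp i).map' n (n + 1))) :
    ∃ ε : Ext.{w} F.right X n, Resolves F i ε := by
  induction n generalizing X with
  | zero =>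
    change Epi i at he
    have := isIso_of_mono_of_epi i
    exact ⟨_, asIso i, rfl, rfl⟩
  | succ n ih =>
    have h0 : i ≫ F.map' 0 1 = 0 := hF.toIsComplex.zero 0
    have hex : (ShortComplex.mk i (F.map' 0 1) h0).Exact := hF.exact 0
    have hFe : F.Exact := hF.δ₀
    let j : cokernel i ⟶ F.obj' 1 := cokernel.desc i (F.map' 0 1) h0
    have hj : cokernel.π i ≫ j = F.map' 0 1 := cokernel.π_desc _ _ _
    have hjm : Mono j := hex.mono_cokernelDesc
    have hπ : Epi (cokernel.π i) := inferInstance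
    obtain ⟨ε, hε⟩ := ih F.δ₀ (X := cokernel i) j (hi := hjm) (by
      obtain - | n := n
      · exact ComposableArrows.exact₁ _
      · have h1 : F.map' 0 1 ≫ F.map' 1 2 = 0 := hFe.toIsComplex.zero 0
        have h2 : j ≫ F.map' 1 2 = 0 := by
          rw [← cancel_epi (cokernel.π i), ← Category.assoc, hj, h1, comp_zero]
        refine ComposableArrows.exact_of_δ₀ (ComposableArrows.exact₂_mk _ h2 ?_) hFe.δ₀
        have hex₁ : (ShortComplex.mk _ _ h1).Exact := hFe.exact 0
        let φ : ShortComplex.mk _ _ h1 ⟶ ShortComplex.mk _ _ h2 :=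
          { τ₁ := cokernel.π i, τ₂ := 𝟙 _, τ₃ := 𝟙 _,
            comm₁₂ := hj.trans (Category.comp_id _).symm }
        have : Epi φ.τ₁ := hπ
        have : IsIso φ.τ₂ := by dsimp [φ]; infer_instance
        have : Mono φ.τ₃ := by dsimp [φ]; infer_instance
        exact (ShortComplex.exact_iff_of_epi_of_isIso_of_mono φ).1 hex₁) (by
      obtain - | n := n
      · change Epi (F.map' 0 1) at he
        rw [← hj] at he
        exact epi_of_epi (cokernel.π i) j
      · exact he)
    exact ⟨_, cokernel i, cokernel.π i, j, cokernel.condition i, shortExact_cokernel i, ε, hj, hε,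
      rfl⟩

end Resolves

section

variable {M : ObjectProperty A}

omit [HasExt.{w} A] in
-- Embed the cokernel of one map into an object of `M`: the resulting morphism factors through the
-- next map, so it kills the kernel of that map.
lemma IsDCokernel.exact_composableArrows (hM : IsCogenerating M) {d : ℕ}
    {S : ComposableArrows A (d + 1)} (hS : IsDCokernel M S) : S.Exact := by
  have h0 (k : ℕ) (hk : k < d) : S.map' k (k + 1) ≫ S.map' (k + 1) (k + 2) = 0 :=
    (hS.exact _ (hS.mem ⟨k + 2, by lia⟩) k hk (S.map' (k + 1) (k + 2))).2
      ⟨𝟙 _, Category.comp_id _⟩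
  refine { zero := fun k hk => h0 k (by lia), exact := fun k hk => ?_ }
  rw [ShortComplex.exact_iff_kernel_ι_comp_cokernel_π_zero]
  change kernel.ι (S.map' (k + 1) (k + 2)) ≫ cokernel.π (S.map' k (k + 1)) = 0
  obtain ⟨N, c, hN, hc⟩ := hM (cokernel (S.map' k (k + 1)))
  obtain ⟨t, ht⟩ := (hS.exact N hN k (by lia) (cokernel.π (S.map' k (k + 1)) ≫ c)).1
    (by simp)
  dsimp only at ht
  rw [← cancel_mono c, Category.assoc, ← ht, kernel.condition_assoc, zero_comp, zero_comp]

omit [HasExt.{w} A] in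
lemma IsDCokernel.epi (hM : IsCogenerating M) {d : ℕ}
    {S : ComposableArrows A (d + 1)} (hS : IsDCokernel M S) : Epi (S.map' d (d + 1)) := by
  refine Preadditive.epi_of_cancel_zero _ fun {Z} g hg => ?_
  obtain ⟨N, c, hN, hc⟩ := hM Z
  rw [← cancel_mono c, zero_comp]
  refine hS.injective N hN ?_
  dsimp only
  rw [← Category.assoc, hg, zero_comp, comp_zero]

omit [HasExt.{w} A] in
lemma IsDKernel.mono (hM : IsGenerating M) {d : ℕ}
    {S : ComposableArrows A (d + 1)} (hS : IsDKernel M S) : Mono (S.map' 0 1) := by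
  refine Preadditive.mono_of_cancel_zero _ fun {Z} g hg => ?_
  obtain ⟨N, c, hN, hc⟩ := hM Z
  rw [← cancel_epi c, comp_zero]
  refine hS.injective N hN ?_
  dsimp only
  rw [Category.assoc, hg, comp_zero, zero_comp]

/-- The class of a sequence with monic first map which gives a `d`-cokernel of that map. -/
lemma IsDCokernel.exists_resolves (hM : IsCogenerating M) {d : ℕ}
    {S : ComposableArrows A (d + 1)} (hS : IsDCokernel M S) [Mono (S.map' 0 1)] :
    ∃ ε : Ext.{w} S.right S.left d,
      Resolves (X := S.left) (S.δ₀ : ComposableArrows A d) (S.map' 0 1) ε := by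
  have hex := hS.exact_composableArrows hM
  have hepi := hS.epi hM
  obtain ⟨F, X, i, rfl⟩ := S.precomp_surjective
  exact Resolves.exists_of_exact F i (hi := ‹_›) hex hepi

end

end HigherExt

/-! ### Decomposition into indecomposables, and consequences of closure under `d`-quotients -/

namespace HigherExt

variable {A : Type u} [Category.{v} A] [Abelian A]

/-- In a category of artinian objects, a property which is stable under isomorphisms and binary
biproducts and holds for zero objects and indecomposable objects holds for all objects. -/
lemma indecomposable_induction (hA : ∀ X : A, IsArtinianObject X) {Q : A → Prop}
    (of_iso : ∀ {X Y : A}, (X ≅ Y) → Q X → Q Y) (zero : ∀ X : A, IsZero X → Q X)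
    (indec : ∀ X : A, Indecomposable X → Q X)
    (sum : ∀ X Y : A, Q X → Q Y → Q (X ⊞ Y)) (X : A) : Q X := by
  have := hA X
  suffices ∀ S : Subobject X, Q (S : A) from of_iso (asIso (⊤ : Subobject X).arrow) (this ⊤)
  intro S
  induction S using WellFoundedLT.induction with
  | ind S ih =>
  by_cases h0 : IsZero (S : A)
  · exact zero _ h0
  by_cases h1 : Indecomposable (S : A)
  · exact indec _ h1
  -- A summand with nonzero complement is a strictly smaller subobject, so the induction hypothesis
  -- applies to it.
  have key (Y Z : A) (s : Y ⟶ (S : A)) [Mono s] (p : (S : A) ⟶ Z) [Epi p] (w : s ≫ p = 0)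
      (hZ : ¬ IsZero Z) : Q Y := by
    refine of_iso (Subobject.underlyingIso (s ≫ S.arrow)) (ih _ (lt_of_le_of_ne ?_ ?_))
    · exact Subobject.mk_le_of_comm s rfl
    · intro h
      apply hZ
      have hle : S ≤ Subobject.mk (s ≫ S.arrow) := h.ge
      have hs : Subobject.ofLEMk S (s ≫ S.arrow) hle ≫ s = 𝟙 _ := by
        rw [← cancel_mono S.arrow, Category.assoc, Subobject.ofLEMk_comp, Category.id_comp]
      have hp : p = 0 := by
        rw [← Category.id_comp p, ← hs, Category.assoc, w, comp_zero]
      rw [IsZero.iff_id_eq_zero, ← cancel_epi p, hp, zero_comp, zero_comp]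
  simp only [Indecomposable, not_and, not_forall, not_or] at h1
  obtain ⟨Y, Z, e, hY, hZ⟩ := h1 h0
  exact of_iso e.symm (sum Y Z
    (key Y Z (biprod.inl ≫ e.inv) (e.hom ≫ biprod.snd) (by simp) hZ)
    (key Z Y (biprod.inr ≫ e.inv) (e.hom ≫ biprod.fst) (by simp) hY))

section Quotients

variable {M U : ObjectProperty A} {d : ℕ}

lemma ClosedUnderDQuotients.exists_weak_cokernel (hquot : ClosedUnderDQuotients M U d)
    (hd : 1 ≤ d) {N V : A} (f : N ⟶ V) (hN : M N) (hV : U V) :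
    ∃ (G : A) (p : V ⟶ G), U G ∧ f ≫ p = 0 ∧
      ∀ (T : A), M T → ∀ u : V ⟶ T, f ≫ u = 0 → ∃ v, p ≫ v = u := by
  obtain ⟨S, hS, ⟨e⟩, hSU⟩ := hquot N V f hN hV
  have w₁ : e.inv.left ≫ S.map' 0 1 = f ≫ e.inv.right := e.inv.w
  have w₂ : e.hom.left ≫ f = S.map' 0 1 ≫ e.hom.right := e.hom.w
  have hr : e.inv.right ≫ e.hom.right = 𝟙 V := Arrow.inv_hom_id_right e
  have ex (T : A) (hT : M T) := hS.exact T hT 0 (by lia)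
  refine ⟨S.obj' 2, e.inv.right ≫ S.map' 1 2, hSU 0 (by lia), ?_, fun T hT u hu => ?_⟩
  · have h0 : S.map' 0 1 ≫ S.map' 1 2 = 0 :=
      (ex _ (hS.mem ⟨2, by lia⟩) (S.map' 1 2)).2 ⟨𝟙 _, Category.comp_id _⟩
    rw [← Category.assoc, ← w₁, Category.assoc, h0, comp_zero]
  · obtain ⟨v, hv⟩ := (ex T hT (e.hom.right ≫ u)).1 (by
      change S.map' 0 1 ≫ e.hom.right ≫ u = 0
      rw [← Category.assoc, ← w₂, Category.assoc, hu, comp_zero])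
    refine ⟨v, ?_⟩
    change S.map' 1 2 ≫ v = e.hom.right ≫ u at hv
    rw [Category.assoc, hv, ← Category.assoc, hr, Category.id_comp]

/-- Each quotient `F` of an object of `U` has a left approximation which lies in `U`. -/
lemma ClosedUnderDQuotients.exists_of_epi (hquot : ClosedUnderDQuotients M U d)
    (hd : 1 ≤ d) (hM : IsGenerating M) {V F : A} (p : V ⟶ F) [Epi p] (hV : U V) :
    ∃ (G : A) (t : F ⟶ G), U G ∧ ∀ (T : A), M T → ∀ u : F ⟶ T, ∃ v, t ≫ v = u := by
  -- Covering the kernel by an object of `M` presents `F` as the cokernel of a morphism in `M`; the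
  -- first term of its `d`-cokernel is the required `G`.
  obtain ⟨N, c, hN, hc⟩ := hM (kernel p)
  obtain ⟨G, r, hG, hr, H⟩ := hquot.exists_weak_cokernel hd (c ≫ kernel.ι p) hN hV
  have hp := (shortExact_kernel p).exact
  have hr' : kernel.ι p ≫ r = 0 := by
    rwa [← cancel_epi c, comp_zero, ← Category.assoc]
  have : Epi (ShortComplex.mk (kernel.ι p) p (kernel.condition p)).g := ‹_›
  obtain ⟨t, ht⟩ : ∃ t, p ≫ t = r := ⟨_, hp.g_desc r hr'⟩
  refine ⟨G, t, hG, fun T hT u => ?_⟩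
  obtain ⟨v, hv⟩ := H T hT (p ≫ u) (by simp)
  exact ⟨v, by rw [← cancel_epi p, ← Category.assoc, ht, hv]⟩

variable [HasExt.{w} A]

/-- The cokernel of a monomorphism into an object of `U` has a finite coresolution in `U`. -/
lemma ClosedUnderDQuotients.exists_splice {n : ℕ} (hquot : ClosedUnderDQuotients M U (n + 1))
    (hM : IsCogenerating M) {X G : A} (j : X ⟶ G) [Mono j] (hX : M X) (hG : U G) :
    ∃ (C : A) (q : G ⟶ C) (w : j ≫ q = 0) (_ : (ShortComplex.mk j q w).ShortExact) (Z : A)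
      (ε : Ext.{w} Z C n), U Z ∧ Splice U n C Z ε := by
  obtain ⟨S, hS, ⟨e⟩, hSU⟩ := hquot X G j hX hG
  have w₁ : e.inv.left ≫ S.map' 0 1 = j ≫ e.inv.right := e.inv.w
  have w₂ : e.hom.left ≫ j = S.map' 0 1 ≫ e.hom.right := e.hom.w
  have hmono : Mono (S.map' 0 1) := by
    have : IsIso e.hom.left := inferInstance
    have : Mono (S.map' 0 1 ≫ e.hom.right) := w₂ ▸ mono_comp _ _
    exact mono_of_mono _ e.hom.right
  obtain ⟨ε, C, q, i, w, hC, ε', hq, h, rfl⟩ := hS.exists_resolves.{w} hM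
  change S.obj' 1 ⟶ C at q
  let a : S.left ≅ X := Arrow.leftFunc.mapIso e
  let b : S.obj' 1 ≅ G := Arrow.rightFunc.mapIso e
  have w' : j ≫ b.inv ≫ q = 0 := by
    have w₁' : j ≫ b.inv = e.inv.left ≫ S.map' 0 1 := w₁.symm
    rw [← Category.assoc, w₁', Category.assoc]
    exact (congrArg _ w).trans comp_zero
  refine ⟨C, b.inv ≫ q, w', ?_, _, ε', hSU n (by lia),
    h.splice fun k hk => hSU k (by lia)⟩
  refine ShortComplex.shortExact_of_iso (ShortComplex.isoMk a b (Iso.refl C) w₂ ?_) hC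
  change b.hom ≫ b.inv ≫ q = q ≫ 𝟙 C
  rw [Iso.hom_inv_id_assoc, Category.comp_id]

end Quotients

end HigherExt

/-! ### Universally killed classes and splices in `U` -/

namespace HigherExt

variable {A : Type u} [Category.{v} A] [Abelian A] [HasExt.{w} A]

/-- `ε` is killed by a morphism to an object of `U` through which every morphism to an object of
`M` killing `ε` factors. -/
def UniversallyKilled (M U : ObjectProperty A) {X Y : A} {n : ℕ} (ε : Ext.{w} Y X n) : Prop :=
  ∃ (G : A) (j : X ⟶ G), U G ∧ ε.comp (Ext.mk₀ j) (add_zero n) = 0 ∧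
    ∀ (N : A), M N → ∀ u : X ⟶ N, ε.comp (Ext.mk₀ u) (add_zero n) = 0 → ∃ v, j ≫ v = u

namespace UniversallyKilled

variable {M U : ObjectProperty A} {d n : ℕ} {X Y : A}

lemma zero (hX : U X) : UniversallyKilled M U (0 : Ext.{w} Y X n) :=
  ⟨X, 𝟙 X, hX, Ext.zero_comp .., fun _ _ u _ => ⟨u, Category.id_comp u⟩⟩

lemma of_iso {X' Y' : A} (a : X ≅ X') (b : Y ≅ Y') {ε : Ext.{w} Y X n} {ε' : Ext.{w} Y' X' n}
    (h : ε.comp (Ext.mk₀ a.hom) (add_zero n) = (Ext.mk₀ b.hom).comp ε' (zero_add n))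
    (hε : UniversallyKilled M U ε') : UniversallyKilled M U ε := by
  obtain ⟨G, j, hG, hj, H⟩ := hε
  refine ⟨G, a.hom ≫ j, hG, ?_, fun N hN u hu => ?_⟩
  · rw [← Ext.mk₀_comp_mk₀, ← Ext.comp_assoc_of_third_deg_zero, h,
      Ext.comp_assoc_of_third_deg_zero, hj, Ext.comp_zero]
  · have h' : ε' = ((Ext.mk₀ b.inv).comp ε (zero_add n)).comp (Ext.mk₀ a.hom) (add_zero n) := by
      rw [Ext.comp_assoc_of_third_deg_zero, h, Ext.mk₀_comp_mk₀_assoc, b.inv_hom_id,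
        Ext.mk₀_id_comp]
    obtain ⟨v, hv⟩ := H N hN (a.inv ≫ u) (by
      rw [h', Ext.comp_assoc_of_third_deg_zero, Ext.mk₀_comp_mk₀, a.hom_inv_id_assoc,
        Ext.comp_assoc_of_third_deg_zero, hu, Ext.comp_zero])
    exact ⟨v, by rw [Category.assoc, hv, a.hom_inv_id_assoc]⟩

lemma of_splice (hM : IsClusterTilting.{w} d M) (hUM : U ≤ M) (hd : n + 1 ≤ d)
    {ε : Ext.{w} Y X (n + 1)} (h : Splice U (n + 1) X Y ε) : UniversallyKilled M U ε := by
  obtain ⟨E, j, hE, -, hj, H⟩ := h.exists_first hM hUM hd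
  exact ⟨E, j, hE, hj, H⟩

/-- A universally killed class in degree `d` between objects of `U` is the class of a sequence
in `U`. -/
theorem splice (hM : IsClusterTilting.{w} (n + 1) M) (hUM : U ≤ M)
    (hU : IsAdditiveSubcategory U) [U.IsStableUnderRetracts]
    (hquot : ClosedUnderDQuotients M U (n + 1)) (hX : U X) (hY : U Y) {ε : Ext.{w} Y X (n + 1)}
    (hε : UniversallyKilled M U ε) : Splice U (n + 1) X Y ε := by
  obtain ⟨G, j, hG, hjε, H⟩ := hε
  obtain ⟨C, q, w, hS, Z, ε', hZ, hC, ⟨φ, hφ⟩, ψ, hψ⟩ :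
      ∃ (C : A) (q : G ⟶ C) (w : j ≫ q = 0)
        (hS : (ShortComplex.mk j q w).ShortExact) (Z : A) (ε' : Ext.{w} Z C n), U Z ∧
        Splice U n C Z ε' ∧ (∃ φ : Y ⟶ Z, (Ext.mk₀ φ).comp (ε'.comp hS.extClass rfl)
          (zero_add (n + 1)) = ε) ∧ ∃ ψ : Z ⟶ Y, (Ext.mk₀ ψ).comp ε (zero_add (n + 1)) =
            ε'.comp hS.extClass rfl := by
    obtain - | ⟨T, hT, hT₂, η, hη⟩ := hM.splice (by lia) (hUM _ hX) (hUM _ hY) ε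
    have hTf : (η.comp hT.extClass rfl).comp (Ext.mk₀ T.f) (add_zero _) = 0 := by
      rw [Ext.comp_assoc (h := by lia) (h₂₃ := add_zero 1), hT.extClass_comp, Ext.comp_zero]
    -- Realising `ε` in `M` gives a monomorphism `T.f` killing `ε`. It factors through `j`, so `j`
    -- is monic, and `T.f` also kills the new class, which makes that class a pullback of `ε`.
    obtain ⟨v, hv⟩ := H _ hT₂ T.f hTf
    have hj : Mono j := by
      have := hT.mono_f
      rw [← hv] at this
      exact mono_of_mono j v
    obtain ⟨C, q, w, hS, Z, ε', hZ, hC⟩ := hquot.exists_splice.{w} hM.cogenerating j (hUM _ hX) hG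
    refine ⟨C, q, w, hS, Z, ε', hZ, hC,
      (hC.mono hUM).exists_mk₀_comp_eq_of_first hM hS (hUM _ hY) le_rfl _ hjε,
      hη.exists_mk₀_comp_eq_of_first hM hT (hUM _ hZ) le_rfl _ ?_⟩
    rw [← hv, ← Ext.mk₀_comp_mk₀, ← Ext.comp_assoc_of_third_deg_zero,
      Ext.comp_assoc (h := by lia) (h₂₃ := add_zero 1), hS.extClass_comp, Ext.comp_zero,
      Ext.zero_comp]
  have hζ : Splice U (n + 1) X Z (ε'.comp hS.extClass rfl) := .succ _ hS hG ε' hC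
  obtain ⟨K, E, f, g, w', hS', ζ₀, hE, h₀, hζ'⟩ := hζ.exists_append
  -- As `ψ ≫ φ` fixes the class on `Z`, its difference from the identity kills that class, hence
  -- already the class of the last short exact sequence, and so lifts along `g`.
  have ha : (Ext.mk₀ (𝟙 Z - ψ ≫ φ)).comp (ε'.comp hS.extClass rfl) (zero_add (n + 1)) = 0 := by
    rw [sub_eq_add_neg, Ext.mk₀_add, Ext.mk₀_neg, Ext.add_comp, Ext.neg_comp, Ext.mk₀_id_comp,
      ← Ext.mk₀_comp_mk₀_assoc, hφ, hψ, add_neg_cancel]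
  have ha' : (Ext.mk₀ (𝟙 Z - ψ ≫ φ)).comp hS'.extClass (zero_add 1) = 0 := by
    refine (h₀.mono hUM).eq_zero_of_comp_right hM (hUM _ hZ) le_rfl (add_comm 1 n) le_rfl _ ?_
    rw [Ext.comp_assoc (h₁₂ := zero_add 1) (h₂₃ := add_comm 1 n) (h := by lia), ← hζ', ha]
  obtain ⟨b, hb⟩ := Ext.covariant_sequence_exact₃ Z hS' _ rfl ha'
  obtain ⟨b, rfl⟩ := (Ext.mk₀_bijective _ _).2 b
  have hb' : b ≫ g = 𝟙 Z - ψ ≫ φ := (Ext.mk₀_bijective _ _).1 (by simpa using hb)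
  let δ : E ⊞ Y ⟶ Z := biprod.fst ≫ g - biprod.snd ≫ φ
  have hδ : (biprod.fst - δ ≫ b) ≫ g = (biprod.snd + δ ≫ ψ) ≫ φ := by
    rw [Preadditive.sub_comp, Preadditive.add_comp, Category.assoc, hb', Category.assoc,
      Preadditive.comp_sub, Category.comp_id]
    dsimp [δ]
    abel
  -- The pullback is the kernel of `δ`, which is split epi with section given by `b` and `-ψ`; so it
  -- is a direct summand of `E ⊞ Y`.
  have hW : U (pullback g φ) := by
    refine U.prop_of_retract ⟨biprod.lift (pullback.fst g φ) (pullback.snd g φ),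
      pullback.lift _ _ hδ, ?_⟩ (hU.biprod hE hY)
    have h0 : biprod.lift (pullback.fst g φ) (pullback.snd g φ) ≫ δ = 0 := by
      simp [δ, pullback.condition]
    apply pullback.hom_ext
    · rw [Category.assoc, pullback.lift_fst, Preadditive.comp_sub, reassoc_of% h0]
      simp
    · rw [Category.assoc, pullback.lift_snd, Preadditive.comp_add, reassoc_of% h0]
      simp
  have := h₀.append (shortExact_pullback hS' φ) hW
  rw [extClass_pullback hS' φ,
    Ext.comp_assoc (h₁₂ := zero_add 1) (h₂₃ := add_comm 1 n) (h := by lia), ← hζ', hφ] at this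
  exact this

end UniversallyKilled

end HigherExt

/-! ### Direct sums of end terms -/

namespace HigherExt

variable {A : Type u} [Category.{v} A] [Abelian A] [HasExt.{w} A]

namespace UniversallyKilled

variable {M U : ObjectProperty A} {d n : ℕ}

/-- A morphism kills `ε` if and only if it kills both restrictions, that is, factors through both
`j₁` and `j₂`, hence through their pushout. The pushout need not lie in `M` but is a quotient of `G₁
⊞ G₂`. -/
lemma of_biprod_left (hM : IsGenerating M) (hU : IsAdditiveSubcategory U)
    (hquot : ClosedUnderDQuotients M U d) (hd : 1 ≤ d) {X Y₁ Y₂ : A} {ε : Ext.{w} (Y₁ ⊞ Y₂) X n}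
    (h₁ : UniversallyKilled M U ((Ext.mk₀ biprod.inl).comp ε (zero_add n)))
    (h₂ : UniversallyKilled M U ((Ext.mk₀ biprod.inr).comp ε (zero_add n))) :
    UniversallyKilled M U ε := by
  obtain ⟨G₁, j₁, hG₁, hj₁, H₁⟩ := h₁
  obtain ⟨G₂, j₂, hG₂, hj₂, H₂⟩ := h₂
  let p : G₁ ⊞ G₂ ⟶ pushout j₁ j₂ := biprod.desc (pushout.inl j₁ j₂) (pushout.inr j₁ j₂)
  have : Epi p := Preadditive.epi_of_cancel_zero _ fun g hg => by
    apply pushout.hom_ext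
    · rw [← biprod.inl_desc (pushout.inl j₁ j₂) (pushout.inr j₁ j₂), Category.assoc, hg]
      simp
    · rw [← biprod.inr_desc (pushout.inl j₁ j₂) (pushout.inr j₁ j₂), Category.assoc, hg]
      simp
  obtain ⟨G, t, hG, H⟩ := hquot.exists_of_epi hd hM p (hU.biprod hG₁ hG₂)
  refine ⟨G, j₁ ≫ pushout.inl j₁ j₂ ≫ t, hG, ?_, fun N hN u hu => ?_⟩
  · refine Ext.biprod_ext ?_ ?_
    · rw [← Ext.comp_assoc_of_third_deg_zero, ← Ext.mk₀_comp_mk₀,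
        ← Ext.comp_assoc_of_third_deg_zero, hj₁, Ext.zero_comp, Ext.comp_zero]
    · rw [pushout.condition_assoc, ← Ext.comp_assoc_of_third_deg_zero, ← Ext.mk₀_comp_mk₀,
        ← Ext.comp_assoc_of_third_deg_zero, hj₂, Ext.zero_comp, Ext.comp_zero]
  · obtain ⟨v₁, hv₁⟩ := H₁ N hN u (by rw [Ext.comp_assoc_of_third_deg_zero, hu, Ext.comp_zero])
    obtain ⟨v₂, hv₂⟩ := H₂ N hN u (by rw [Ext.comp_assoc_of_third_deg_zero, hu, Ext.comp_zero])
    obtain ⟨v, hv⟩ := H N hN (pushout.desc v₁ v₂ (hv₁.trans hv₂.symm))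
    exact ⟨v, by rw [Category.assoc, Category.assoc, hv, pushout.inl_desc, hv₁]⟩

/-- Let `ε₁`, `ε₂` be the components of `ε`. If `(u₁, u₂)` kills `ε`, then `u₂` kills the pullback
of `ε₂` along the last map `q` of the splice of `ε₁`, so `u₂ = h ≫ v`. With `θ` satisfying `ε₁θ =
ε₂h`, the morphism `u₁ + θ ≫ v` kills `ε₁` and factors through `e`. This dictates the triangular
morphism to `E₁ ⊞ G`. -/
lemma of_biprod_right (hM : IsClusterTilting.{w} d M) (hUM : U ≤ M)
    (hU : IsAdditiveSubcategory U) (hd : n + 1 ≤ d) {X₁ X₂ Y : A}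
    {ε : Ext.{w} Y (X₁ ⊞ X₂) (n + 1)}
    (h₁ : Splice U (n + 1) X₁ Y (ε.comp (Ext.mk₀ biprod.fst) (add_zero _)))
    (h₂ : ∀ Y', U Y' → ∀ η : Ext.{w} Y' X₂ (n + 1), UniversallyKilled M U η) :
    UniversallyKilled M U ε := by
  obtain ⟨E₁, e, hE₁, -, he, H₁⟩ := h₁.exists_first hM hUM hd
  obtain ⟨E, q, hE, -, hq, H⟩ := h₁.exists_comp_eq_of_last hM hUM
  obtain ⟨G, h, hG, hh, H₂⟩ := h₂ E hE
    ((Ext.mk₀ q).comp (ε.comp (Ext.mk₀ biprod.snd) (add_zero _)) (zero_add _))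
  obtain ⟨θ, hθ⟩ := H G (hUM _ hG) 0 (n + 1) rfl hd
    ((ε.comp (Ext.mk₀ biprod.snd) (add_zero _)).comp (Ext.mk₀ h) (add_zero _))
    (by rw [← Ext.comp_assoc_of_third_deg_zero, hh])
  obtain ⟨θ, rfl⟩ := (Ext.mk₀_bijective _ _).2 θ
  refine ⟨E₁ ⊞ G, (biprod.fst ≫ e) ≫ biprod.inl +
    (biprod.snd ≫ h + -(biprod.fst ≫ θ)) ≫ biprod.inr, hU.biprod hE₁ hG, ?_, fun N hN u hu => ?_⟩
  · have key : ε.comp (Ext.mk₀ (biprod.snd ≫ h + -(biprod.fst ≫ θ))) (add_zero _) = 0 := by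
      rw [Ext.mk₀_add, Ext.mk₀_neg, Ext.comp_add, Ext.comp_neg,
        ← Ext.mk₀_comp_mk₀, ← Ext.mk₀_comp_mk₀, ← Ext.comp_assoc_of_third_deg_zero,
        ← Ext.comp_assoc_of_third_deg_zero, hθ, add_neg_cancel]
    rw [Ext.mk₀_add, Ext.comp_add, ← Ext.mk₀_comp_mk₀, ← Ext.mk₀_comp_mk₀, ← Ext.mk₀_comp_mk₀,
      ← Ext.comp_assoc_of_third_deg_zero, ← Ext.comp_assoc_of_third_deg_zero,
      ← Ext.comp_assoc_of_third_deg_zero, he, key, Ext.zero_comp, Ext.zero_comp, add_zero]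
  · have hu' : (ε.comp (Ext.mk₀ biprod.fst) (add_zero _)).comp (Ext.mk₀ (biprod.inl ≫ u))
        (add_zero _) + (ε.comp (Ext.mk₀ biprod.snd) (add_zero _)).comp (Ext.mk₀ (biprod.inr ≫ u))
          (add_zero _) = 0 := by
      rw [Ext.comp_assoc_of_third_deg_zero, Ext.comp_assoc_of_third_deg_zero, Ext.mk₀_comp_mk₀,
        Ext.mk₀_comp_mk₀, ← Ext.comp_add, ← Ext.mk₀_add, ← Category.assoc, ← Category.assoc,
        ← Preadditive.add_comp, biprod.total, Category.id_comp, hu]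
    obtain ⟨v, hv⟩ := H₂ N hN (biprod.inr ≫ u) (by
      rw [Ext.comp_assoc_of_third_deg_zero, eq_neg_of_add_eq_zero_right hu', Ext.comp_neg,
        ← Ext.comp_assoc_of_third_deg_zero, hq, Ext.zero_comp, neg_zero])
    have hv' : (ε.comp (Ext.mk₀ biprod.fst) (add_zero _)).comp (Ext.mk₀ (θ ≫ v)) (add_zero _) =
        (ε.comp (Ext.mk₀ biprod.snd) (add_zero _)).comp (Ext.mk₀ (biprod.inr ≫ u))
          (add_zero _) := by
      rw [← Ext.mk₀_comp_mk₀, ← Ext.comp_assoc_of_third_deg_zero, hθ,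
        Ext.comp_assoc_of_third_deg_zero, Ext.mk₀_comp_mk₀, hv]
    obtain ⟨a, ha⟩ := H₁ N hN (biprod.inl ≫ u + θ ≫ v) (by
      rw [Ext.mk₀_add, Ext.comp_add, hv', hu'])
    refine ⟨biprod.desc a v, ?_⟩
    apply biprod.hom_ext'
    · simp [ha]
    · simp [hv]

end UniversallyKilled

lemma Ext.conjugate_eq_iff {L L' R R' X Y : A} {n : ℕ} (l : L ≅ X) (l' : L' ≅ X) (r : R ≅ Y)
    (r' : R' ≅ Y) {u : L ⟶ L'} {g : R ⟶ R'} (hl : u ≫ l'.hom = l.hom) (hr : g ≫ r'.hom = r.hom)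
    (ε ε' : Ext.{w} Y X n) :
    (((Ext.mk₀ r.hom).comp ε (zero_add n)).comp (Ext.mk₀ l.inv) (add_zero n)).comp (Ext.mk₀ u)
        (add_zero n) =
      (Ext.mk₀ g).comp (((Ext.mk₀ r'.hom).comp ε' (zero_add n)).comp (Ext.mk₀ l'.inv)
        (add_zero n)) (zero_add n) ↔ ε = ε' := by
  have hl' : l.inv ≫ u = l'.inv := by
    rw [Iso.inv_comp_eq, ← hl, Category.assoc, l'.hom_inv_id, Category.comp_id]
  rw [Ext.comp_assoc_of_third_deg_zero _ _ (Ext.mk₀ u), Ext.mk₀_comp_mk₀, hl',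
    Ext.comp_assoc_of_third_deg_zero, Ext.comp_assoc_of_third_deg_zero, Ext.mk₀_comp_mk₀_assoc, hr]
  refine ⟨fun h => ?_, fun h => by rw [h]⟩
  have := congrArg (fun x => ((Ext.mk₀ r.inv).comp x (zero_add n)).comp (Ext.mk₀ l'.hom)
    (add_zero n)) h
  simpa using this

/-! ### Yoneda classes of `d`-extensions -/

namespace DExtension

variable {M P : ObjectProperty A} {d : ℕ} {X Y : A}

/-- `E.HasClass ε` says that `ε` is the Yoneda class of the `d`-extension `E`. -/
def HasClass (E : DExtension M d X Y) (ε : Ext.{w} Y X d) : Prop :=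
  Resolves (X := E.seq.left) (E.seq.δ₀ : ComposableArrows A d) (E.seq.map' 0 1)
    (((Ext.mk₀ E.isoRight.hom).comp ε (zero_add d)).comp (Ext.mk₀ E.isoLeft.inv) (add_zero d))

lemma exists_hasClass (hM : IsClusterTilting.{w} d M) (E : DExtension M d X Y) :
    ∃ ε : Ext.{w} Y X d, E.HasClass ε := by
  have := E.isDKernel.mono hM.generating
  obtain ⟨ε, hε⟩ := E.isDCokernel.exists_resolves.{w} hM.cogenerating
  refine ⟨((Ext.mk₀ E.isoRight.inv).comp ε (zero_add d)).comp (Ext.mk₀ E.isoLeft.hom)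
    (add_zero d), ?_⟩
  unfold HasClass
  convert hε
  rw [← Ext.comp_assoc_of_third_deg_zero, Ext.mk₀_comp_mk₀_assoc, E.isoRight.hom_inv_id,
    Ext.mk₀_id_comp, Ext.comp_assoc_of_third_deg_zero, Ext.mk₀_comp_mk₀, E.isoLeft.hom_inv_id,
    Ext.comp_mk₀_id]

lemma _root_.HigherExt.Splice.exists_dExtension (hM : IsClusterTilting.{w} d M) (hPM : P ≤ M)
    (hP : IsAdditiveSubcategory P) {ε : Ext.{w} Y X d} (h : Splice P d X Y ε) (hX : P X)
    (hY : P Y) : ∃ E : DExtension M d X Y, E.HasClass ε ∧ ∀ i, P (E.seq.obj i) := by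
  obtain ⟨F, i, r, hF, hFP⟩ := h.exists_resolves
  have hFP' (k) : P (F.obj k) := by
    obtain ⟨k, hk⟩ := k
    obtain hk | rfl := Nat.lt_succ_iff_lt_or_eq.1 hk
    · exact hFP k hk
    · exact hP.of_iso r.symm hY
  refine ⟨⟨F.precomp i, Iso.refl X, r, hF.isDCokernel hM (fun k => hPM _ (hFP' k)) (hPM _ hX),
    hF.isDKernel hM (fun k => hPM _ (hFP' k)) (hPM _ hX)⟩, ?_, ?_⟩
  · unfold HasClass
    exact (Ext.comp_mk₀_id ((Ext.mk₀ r.hom).comp ε (zero_add d))).symm ▸ hF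
  · rintro ⟨- | k, hk⟩
    · exact hX
    · exact hFP' ⟨k, by lia⟩

lemma HasClass.universallyKilled {n : ℕ} (hM : IsClusterTilting.{w} (n + 1) M) (hPM : P ≤ M)
    {E : DExtension M (n + 1) X Y} {ε : Ext.{w} Y X (n + 1)} (h : E.HasClass ε)
    (hE : ∀ i, P (E.seq.obj i)) : UniversallyKilled M P ε := by
  refine .of_iso E.isoLeft.symm E.isoRight.symm ?_
    (.of_splice hM hPM le_rfl (Resolves.splice h fun k hk => hE ⟨k + 1, by lia⟩))
  dsimp
  rw [← Ext.comp_assoc_of_third_deg_zero, Ext.mk₀_comp_mk₀_assoc, E.isoRight.inv_hom_id,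
    Ext.mk₀_id_comp]

lemma HasClass.eq {E E' : DExtension M d X Y} (hEE' : E.Equivalent E') {ε ε' : Ext.{w} Y X d}
    (h : E.HasClass ε) (h' : E'.HasClass ε') : ε = ε' := by
  obtain ⟨φ, hl, hr⟩ := hEE'
  have nat := Resolves.naturality h h' (ComposableArrows.δ₀Functor.map φ)
    (ComposableArrows.app' φ 0) (ComposableArrows.naturality' φ 0 1)
  exact (Ext.conjugate_eq_iff _ _ _ _ hl hr _ _).1 nat

lemma HasClass.equivalent (hM : IsClusterTilting.{w} d M) {E E' : DExtension M d X Y}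
    {ε : Ext.{w} Y X d} (h : E.HasClass ε) (h' : E'.HasClass ε) : E.Equivalent E' := by
  have hl : (E.isoLeft.hom ≫ E'.isoLeft.inv) ≫ E'.isoLeft.hom = E.isoLeft.hom := by simp
  have hr : (E.isoRight.hom ≫ E'.isoRight.inv) ≫ E'.isoRight.hom = E.isoRight.hom := by simp
  obtain ⟨φ, hφ, hφ'⟩ := Resolves.exists_hom hM le_rfl h h' (fun k => E.isDCokernel.mem k.succ)
    (fun k => E'.isDCokernel.mem k.succ) (E.isoLeft.hom ≫ E'.isoLeft.inv)
    (E.isoRight.hom ≫ E'.isoRight.inv) ((Ext.conjugate_eq_iff _ _ _ _ hl hr _ _).2 rfl)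
  refine ⟨ComposableArrows.homMkSucc (E.isoLeft.hom ≫ E'.isoLeft.inv) φ hφ, hl,
    (congrArg (· ≫ E'.isoRight.hom) hφ').trans hr⟩

end DExtension

end HigherExt

/-! ### Reduction to indecomposable end terms and conclusion -/

namespace HigherExt

variable {A : Type u} [Category.{v} A] [Abelian A] [HasExt.{w} A]

lemma ClosedUnderIndecDExtensions.universallyKilled {M U : ObjectProperty A} {n : ℕ}
    (hext : ClosedUnderIndecDExtensions M U (n + 1)) (hM : IsClusterTilting.{w} (n + 1) M)
    (hUM : U ≤ M) {X Y : A} (hX : Indecomposable X) (hY : Indecomposable Y) (hUX : U X)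
    (hUY : U Y) (ε : Ext.{w} Y X (n + 1)) : UniversallyKilled M U ε := by
  obtain ⟨E, hE, -⟩ := (hM.splice (by lia) (hUM _ hUX) (hUM _ hUY) ε).exists_dExtension hM le_rfl
    hM.additive (hUM _ hUX) (hUM _ hUY)
  obtain ⟨E', hEE', hE'⟩ := hext X Y hX hY hUX hUY E
  obtain ⟨ε', hε'⟩ := E'.exists_hasClass hM
  obtain rfl := DExtension.HasClass.eq hEE' hE hε'
  exact hε'.universallyKilled hM hUM hE'

/-- If all classes between indecomposable objects of `U` are universally killed, then so are all
classes between objects of `U`. -/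
lemma universallyKilled_of_indecomposable (hA : IsLengthCategory A) {M U : ObjectProperty A}
    {n : ℕ} (hM : IsClusterTilting.{w} (n + 1) M) (hUM : U ≤ M) (hU : IsAdditiveSubcategory U)
    [U.IsStableUnderRetracts] (hquot : ClosedUnderDQuotients M U (n + 1))
    (hind : ∀ X Y : A, Indecomposable X → Indecomposable Y → U X → U Y →
      ∀ ε : Ext.{w} Y X (n + 1), UniversallyKilled M U ε)
    (X : A) : U X → ∀ Y, U Y → ∀ ε : Ext.{w} Y X (n + 1), UniversallyKilled M U ε := by
  have fst (X Y : A) (h : U (X ⊞ Y)) : U X :=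
    U.prop_of_retract ⟨biprod.inl, biprod.fst, biprod.inl_fst⟩ h
  have snd (X Y : A) (h : U (X ⊞ Y)) : U Y :=
    U.prop_of_retract ⟨biprod.inr, biprod.snd, biprod.inr_snd⟩ h
  induction X using indecomposable_induction hA.artinian with
  | of_iso e ih =>
    intro hX Y hY ε
    exact .of_iso e.symm (Iso.refl Y) (Ext.mk₀_id_comp _).symm (ih (hU.of_iso e.symm hX) Y hY _)
  | zero X hX =>
    intro hUX Y hY ε
    obtain rfl : ε = 0 := by
      rw [← Ext.comp_mk₀_id ε, hX.eq_of_src (𝟙 X) 0, Ext.mk₀_zero, Ext.comp_zero]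
    exact .zero hUX
  | indec X hX =>
    intro hUX Y
    induction Y using indecomposable_induction hA.artinian with
    | of_iso e ih =>
      intro hY ε
      exact .of_iso (Iso.refl X) e.symm
        (by simp : _ = (Ext.mk₀ e.inv).comp ((Ext.mk₀ e.hom).comp ε (zero_add _)) (zero_add _))
        (ih (hU.of_iso e.symm hY) _)
    | zero Y hY =>
      intro _ ε
      obtain rfl : ε = 0 := by
        rw [← Ext.mk₀_id_comp ε, hY.eq_of_src (𝟙 Y) 0, Ext.mk₀_zero, Ext.zero_comp]
      exact .zero hUX
    | indec Y hY => exact fun hUY => hind X Y hX hY hUX hUY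
    | sum Y₁ Y₂ h₁ h₂ =>
      intro hY ε
      exact .of_biprod_left hM.generating hU hquot (by lia) (h₁ (fst _ _ hY) _)
        (h₂ (snd _ _ hY) _)
  | sum X₁ X₂ h₁ h₂ =>
    intro hX Y hY ε
    -- The hypothesis on `X₂` is needed for every second argument in `U`, as it is applied to the
    -- last middle term of a splice; hence the induction on `X` is the outer one.
    exact .of_biprod_right hM hUM hU le_rfl
      ((h₁ (fst _ _ hX) Y hY _).splice hM hUM hU hquot (fst _ _ hX) hY) (h₂ (snd _ _ hX))

end HigherExt

theorem mainTheorem3 {A : Type u} [Category.{v} A] [Abelian A] [HasExt.{w} A]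
    (hA : HigherExt.IsLengthCategory A)
    (d : ℕ) (hd : 1 ≤ d)
    (M : ObjectProperty A) (hM : HigherExt.IsClusterTilting.{w} d M)
    (U : ObjectProperty A) (hUM : U ≤ M)
    (hU : HigherExt.IsAdditiveSubcategory U)
    (hUs : U.IsStableUnderRetracts)
    (hquot : HigherExt.ClosedUnderDQuotients M U d)
    (hext : HigherExt.ClosedUnderIndecDExtensions M U d) :
    HigherExt.ClosedUnderDExtensions M U d := by
  obtain ⟨n, rfl⟩ := Nat.exists_eq_add_of_le' hd
  intro X Y hX hY E
  obtain ⟨ε, hε⟩ := E.exists_hasClass hM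
  have h := HigherExt.universallyKilled_of_indecomposable hA hM hUM hU hquot
    (fun _ _ hX hY hUX hUY => hext.universallyKilled hM hUM hX hY hUX hUY) X hX Y hY ε
  obtain ⟨E', hE', hE'U⟩ := (h.splice hM hUM hU hquot hX hY).exists_dExtension hM hUM hU hX hY
  exact ⟨E', hε.equivalent hM hE', hE'U⟩
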